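/- Let $d\ge 1$ and let $P\subseteq\mathbb{R}^d$ be a $d$-dimensional convex polytope. For a polytope $Q\subseteq\mathbb{R}^d$, let $$\rho_{IQ}(x)=\frac{1}{\|x\|}\operatorname{vol}_{d-1}(Q\cap x^\perp)$$ be the radial function of its intersection body $IQ$, and let $\mathcal{H}(Q)=\bigcup_{w} w^\perp$, where $w$ ranges over the nonzero vertices of $Q$; a chamber of $\mathcal{H}(Q)$ is a connected component of $\mathbb{R}^d\setminus\mathcal{H}(Q)$. Let $\mathcal{L}(P)$ be the union of the affine hyperplanes $\operatorname{aff}(-v_1,\dots,-v_d)$ over all choices of $d$ affinely independent vertices $v_1,\dots,v_d$ of $P$; an open region of $\mathcal{L}(P)$ is a connected component of $\mathbb{R}^d\setminus\mathcal{L}(P)$. Let $R$ be an open region of $\mathcal{L}(P)$, let $t_0\in R$, and let $C_{t_0}$ be a chamber of $\mathcal{H}(P+t_0)$. For $t\in R$, let $C_t$ denote a chamber of $\mathcal{H}(P+t)$ with the same sign vector as $C_{t_0}$, i.e. such that for every vertex $v$ of $P$, either $\langle x,v+t\rangle>0$ for all $x\in C_t$ and $\langle x,v+t_0\rangle>0$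 for all $x\in C_{t_0}$, or both of these hold with $<$ in place of $>$. Then, for $t\in R$, the radial function of $I(P+t)$ restricted to $C_t$ is a polynomial in $t_1,\dots,t_d$ of degree at most $d-1$, whose coefficients are rational functions of $x$. That is, there are a polynomial $p(x,t)\in\mathbb{R}[x_1,\dots,x_d][t_1,\dots,t_d]$ of degree at most $d-1$ in $t$ and a polynomial $q(x)\in\mathbb{R}[x_1,\dots,x_d]$ such that, for all $t\in R$, all such chambers $C_t$ and all $x\in C_t$, $$q(x)\ne 0\quad\text{and}\quad \rho_{I(P+t)}(x)=\frac{p(x,t)}{q(x)}.$$ -/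

import Mathlib

open MeasureTheory

namespace IntersectionBody

/-- Euclidean space of dimension `d`. -/
abbrev E (d : ℕ) : Type := EuclideanSpace ℝ (Fin d)

/-- A full-dimensional convex polytope: the convex hull of finitely many points, whose affine hull
is the whole space. -/
def IsFullDimPolytope {d : ℕ} (P : Set (E d)) : Prop :=
  (∃ S : Set (E d), S.Finite ∧ P = convexHull ℝ S) ∧ affineSpan ℝ P = ⊤

/-- The vertices of a polytope are its extreme points. -/
def vertices {d : ℕ} (P : Set (E d)) : Set (E d) := P.extremePoints ℝ

/-- The translate `P + t`. -/
def translate {d : ℕ} (P : Set (E d)) (t : E d) : Set (E d) := (fun y => y + t) '' P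

/-- The linear hyperplane `x^⊥` of all vectors orthogonal to `x` (the whole space if `x = 0`). -/
def perp {d : ℕ} (x : E d) : Set (E d) := {y | inner ℝ x y = 0}

/-- The positive side of the hyperplane `v^⊥`. -/
def posSide {d : ℕ} (v : E d) : Set (E d) := {x | 0 < inner ℝ x v}

/-- The negative side of the hyperplane `v^⊥`. -/
def negSide {d : ℕ} (v : E d) : Set (E d) := {x | inner ℝ x v < 0}

/-- The radial function of the intersection body of `P`: the `(d-1)`-dimensional Euclidean volume
of `P ∩ x^⊥`, divided by the norm of `x`. Here `μHE[k]` is the `k`-dimensional Hausdorff measure,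
normalized so that it agrees with Lebesgue measure on `k`-dimensional Euclidean spaces. -/
noncomputable def radialFunction {d : ℕ} (P : Set (E d)) (x : E d) : ℝ :=
  (1 / ‖x‖) * (μHE[d - 1] (P ∩ perp x)).toReal

/-- The union of the central arrangement of the hyperplanes `v^⊥`, over the nonzero vertices `v`
of `P`. -/
def centralArrangement {d : ℕ} (P : Set (E d)) : Set (E d) :=
  ⋃ v ∈ {v | v ∈ vertices P ∧ v ≠ 0}, perp v

/-- The union of the affine arrangement of the hyperplanes spanned by `-v₁, …, -v_d`, over all
affinely independent vertices `v₁, …, v_d` of `P`. -/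
def affineArrangement {d : ℕ} (P : Set (E d)) : Set (E d) :=
  ⋃ v ∈ {v : Fin d → E d | (∀ i, v i ∈ vertices P) ∧ AffineIndependent ℝ v},
    (affineSpan ℝ (Set.range fun i => -v i) : Set (E d))

/-- `C` is a connected component of the subset `U`. -/
def IsComponentOf {d : ℕ} (C U : Set (E d)) : Prop :=
  ∃ x ∈ U, C = connectedComponentIn U x

/-- An open chamber of the central arrangement of `P`. -/
def IsChamber {d : ℕ} (P C : Set (E d)) : Prop := IsComponentOf C (centralArrangement P)ᶜ

/-- An open region of the affine arrangement of `P`. -/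
def IsRegion {d : ℕ} (P R : Set (E d)) : Prop := IsComponentOf R (affineArrangement P)ᶜ

/-- The chamber `C` of the central arrangement of `P + t` and the chamber `C'` of the central
arrangement of `P + t'` have the same sign vector, the signs being indexed by the
vertices `v` of `P` (through the vertices `v + t` of `P + t` and `v + t'` of `P + t'`). -/
def SameSignVector {d : ℕ} (P : Set (E d)) (t : E d) (C : Set (E d)) (t' : E d) (C' : Set (E d)) :
    Prop :=
  ∀ v ∈ vertices P,
    (C ⊆ posSide (v + t) ∧ C' ⊆ posSide (v + t')) ∨
      (C ⊆ negSide (v + t) ∧ C' ⊆ negSide (v + t'))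

/-- The value at `(x, t)` of a polynomial in the variables `t₁, …, t_d` whose coefficients are
polynomials in the variables `x₁, …, x_d`. -/
noncomputable def evalAt {d : ℕ} (p : MvPolynomial (Fin d) (MvPolynomial (Fin d) ℝ))
    (x t : E d) : ℝ :=
  MvPolynomial.eval (fun i => t i) (MvPolynomial.map (MvPolynomial.eval fun i => x i) p)

end IntersectionBody

/-!
The sign vector of a chamber alone controls the section volume; the affine arrangement plays no
further role. Write `h y = ⟪x, y + t⟫`, so that `(P + t) ∩ x^⊥` is the translate of the section
`{h = 0}` of `P`. No vertex of `P` lies on `{h = 0}`, and then Fubini's theorem, together with the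
continuity of the volume of parallel sections (`tendsto_volume_slice`), shows that the radial
function at `x` is the derivative at `ε = 0⁺` of the volume of the slab `P ∩ {0 ≤ h < ε}`
(`tendsto_volume_slab_div`). In contrast with the section volume, the slab volume is additive under
dissections of `P`, degenerate or not.

A polytope is dissected into simplices spanned by its own vertices: lift the vertices to generic
heights and project the lower boundary of the convex hull of the lifted points
(`exists_triangulation`). For one simplex the derivative is computed by a recursion on the numbers
of vertices with `h > 0` and `h < 0` (`tendsto_measure_simplex_slab`): an edge from `v` with
`h v > 0` to `w` with `h w < 0` is cut at its zero of `h`, which splits the simplex into two with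
one more vertex on `{h = 0}` each, and whose volumes are the fractions `-h w / (h v - h w)` and
`h v / (h v - h w)` of the original one. When no negative vertex is left, the derivative is that of
a power of a linear function of `ε`.

The denominators `h v - h w = ⟪x, v - w⟫` do not involve `t`, and are nonzero because `h v` and
`h w` have opposite signs; each step multiplies by one factor `h v` or `h w`, which is affine in
`t`. Counting the steps gives degree at most `d - 1` in `t` (`isRationalOn_sectionDensity`).
-/

namespace IntersectionBody

open MeasureTheory Set Filter Topology
open scoped Pointwise

set_option linter.unusedSectionVars false

/-! ### Affine bases and the volume of simplices -/

section AffineBasis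

variable {F : Type*} [NormedAddCommGroup F] [NormedSpace ℝ F]
  {ι : Type*} [Fintype ι]

theorem affineMap_eq_sum_coord (b : AffineBasis ι ℝ F) (h : F →ᵃ[ℝ] ℝ) (y : F) :
    h y = ∑ i, b.coord i y * h (b i) := by
  conv_lhs => rw [← b.affineCombination_coord_eq_self y]
  rw [Finset.map_affineCombination _ _ _ (b.sum_coord_apply_eq_one y),
    Finset.affineCombination_eq_linear_combination _ _ _ (b.sum_coord_apply_eq_one y)]
  simp

variable [DecidableEq ι]

/-- The affine map fixing every point of `b` except `b i`, which it moves to `w`. -/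
noncomputable def moveVertex (b : AffineBasis ι ℝ F) (i : ι) (w : F) : F →ᵃ[ℝ] F :=
  (LinearMap.transvection (b.coord i).linear (w - b i)).toAffineMap +
    AffineMap.const ℝ F (b.coord i 0 • (w - b i))

theorem moveVertex_apply (b : AffineBasis ι ℝ F) (i : ι) (w y : F) :
    moveVertex b i w y = y + b.coord i y • (w - b i) := by
  have h : b.coord i y = (b.coord i).linear y + b.coord i 0 := by
    conv_lhs => rw [AffineMap.decomp (b.coord i)]
    simp
  simp [moveVertex, LinearMap.transvection.apply, h, add_smul, add_assoc]

theorem moveVertex_comp (b : AffineBasis ι ℝ F) (i : ι) (w : F) :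
    moveVertex b i w ∘ b = Function.update b i w := by
  funext j
  by_cases hj : j = i
  · subst hj
    simp [moveVertex_apply]
  · simp [moveVertex_apply, Function.update_of_ne hj, b.coord_apply_ne (Ne.symm hj)]

omit [Fintype ι] [DecidableEq ι] in
theorem linear_coord_sub (b : AffineBasis ι ℝ F) (i : ι) (w : F) :
    1 + (b.coord i).linear (w - b i) = b.coord i w := by
  have := (b.coord i).linearMap_vsub w (b i)
  simp only [vsub_eq_sub] at this
  rw [this]; simp

variable [FiniteDimensional ℝ F]

omit [Fintype ι] [DecidableEq ι] in
theorem det_transvection_coord (b : AffineBasis ι ℝ F) (i : ι) (w : F) :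
    (LinearMap.transvection (b.coord i).linear (w - b i)).det = b.coord i w := by
  rw [LinearMap.transvection.det, linear_coord_sub]

/-- The affine basis obtained from `b` by replacing the point `b i` with a point `w` off the
hyperplane spanned by the other points. -/
noncomputable def replaceVertex (b : AffineBasis ι ℝ F) (i : ι) (w : F) (hw : b.coord i w ≠ 0) :
    AffineBasis ι ℝ F :=
  have ind : AffineIndependent ℝ (Function.update b i w) := by
    rw [← moveVertex_comp]
    refine b.ind.map' _ ?_
    have hdet := det_transvection_coord b i w
    have hinj : Function.Injective
        (LinearMap.transvection (b.coord i).linear (w - b i)) :=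
      ((LinearMap.transvection (b.coord i).linear (w - b i)).equivOfDetNeZero
        (by rw [hdet]; exact hw)).injective
    intro y z hyz
    apply hinj
    simpa [moveVertex] using hyz
  ⟨Function.update b i w, ind,
    (ind.affineSpan_eq_top_iff_card_eq_finrank_add_one).2 b.card_eq_finrank_add_one⟩

variable {b : AffineBasis ι ℝ F} {i : ι} {w : F} (hw : b.coord i w ≠ 0)

@[simp] theorem coe_replaceVertex : ⇑(replaceVertex b i w hw) = Function.update b i w := rfl

/-- Barycentric coordinates before and after replacing a vertex, at the replaced index. -/
theorem coord_eq_replaceVertex_self (y : F) :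
    b.coord i y = (replaceVertex b i w hw).coord i y * b.coord i w := by
  rw [affineMap_eq_sum_coord (replaceVertex b i w hw) (b.coord i) y,
    Finset.sum_eq_single i]
  · simp
  · intro j _ hj
    simp [Function.update_of_ne hj, b.coord_apply_ne (Ne.symm hj)]
  · simp

theorem coord_eq_replaceVertex_of_ne {j : ι} (hj : j ≠ i) (y : F) :
    b.coord j y = (replaceVertex b i w hw).coord j y +
      (replaceVertex b i w hw).coord i y * b.coord j w := by
  rw [affineMap_eq_sum_coord (replaceVertex b i w hw) (b.coord j) y,
    Finset.sum_eq_add_of_mem j i (Finset.mem_univ _) (Finset.mem_univ _) hj]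
  · simp [Function.update_of_ne hj]
  · intro l _ hl
    simp [Function.update_of_ne hl.2, b.coord_apply_ne (Ne.symm hl.1)]

variable [MeasurableSpace F] [BorelSpace F] (μ : Measure F) [μ.IsAddHaarMeasure]

/-- Moving one vertex is an affine map whose linear part is a transvection; its determinant is the
barycentric coordinate of the new vertex. -/
theorem measure_simplex_replaceVertex :
    μ.real (convexHull ℝ (range (replaceVertex b i w hw))) =
      |b.coord i w| * μ.real (convexHull ℝ (range b)) := by
  rw [coe_replaceVertex, ← moveVertex_comp, range_comp, ← AffineMap.image_convexHull]
  have : (moveVertex b i w : F → F) =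
      (fun y => y + b.coord i 0 • (w - b i)) ∘
        (LinearMap.transvection (b.coord i).linear (w - b i)) := by
    funext y; simp [moveVertex]
  rw [this, image_comp, measureReal_def, Set.image_add_right, measure_preimage_add_right,
    Measure.addHaar_image_linearMap, det_transvection_coord, ENNReal.toReal_mul,
    ENNReal.toReal_ofReal (abs_nonneg _), measureReal_def]

omit [DecidableEq ι] in
/-- Cutting a simplex by the half-spaces where the barycentric coordinates are at least `a i`
leaves a translate of its dilation by `1 - ∑ a i`. -/
theorem measure_simplex_inter_coord_ge (b : AffineBasis ι ℝ F) {a : ι → ℝ} (ha : ∀ i, 0 ≤ a i)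
    (hsum : ∑ i, a i < 1) :
    μ.real (convexHull ℝ (range b) ∩ {y | ∀ i, a i ≤ b.coord i y}) =
      (1 - ∑ i, a i) ^ Module.finrank ℝ F * μ.real (convexHull ℝ (range b)) := by
  classical
  set r := 1 - ∑ i, a i with hr
  have hr0 : 0 < r := by rw [hr]; linarith
  set c := ∑ i, a i • b i with hc
  have key : ∀ (l : ι) (z : F), b.coord l (r • z + c) = r * b.coord l z + a l := by
    intro l z
    have hlin : ∀ y, b.coord l y = (b.coord l).linear y + b.coord l 0 := by
      intro y
      conv_lhs => rw [AffineMap.decomp (b.coord l)]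
      simp
    have h1 : (b.coord l).linear c = a l - (∑ i, a i) * b.coord l 0 := by
      rw [hc, map_sum, Finset.sum_mul]
      have : ∀ i, (b.coord l).linear (a i • b i) =
          (if l = i then a i else 0) - a i * b.coord l 0 := by
        intro i
        have := hlin (b i)
        rw [b.coord_apply] at this
        rw [map_smul, smul_eq_mul]
        have h2 : (b.coord l).linear (b i) = (if l = i then 1 else 0) - b.coord l 0 := by
          linarith
        rw [h2]; split_ifs <;> ring
      simp_rw [this, Finset.sum_sub_distrib]
      simp
    rw [hlin, hlin z, map_add, h1, map_smul, smul_eq_mul]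
    rw [hr]; ring
  have himg : convexHull ℝ (range b) ∩ {y | ∀ i, a i ≤ b.coord i y} =
      (fun y => y + c) '' ((fun z => r • z) '' convexHull ℝ (range b)) := by
    rw [image_image, b.convexHull_eq_nonneg_coord]
    ext y
    simp only [mem_inter_iff, mem_ofPred_eq, mem_image]
    constructor
    · rintro ⟨-, hy⟩
      have hy' : r • (r⁻¹ • (y - c)) + c = y := by
        rw [smul_inv_smul₀ hr0.ne']; simp
      refine ⟨r⁻¹ • (y - c), fun l => ?_, hy'⟩
      have := key l (r⁻¹ • (y - c))
      rw [hy'] at this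
      have h2 := hy l
      by_contra! hneg
      nlinarith
    · rintro ⟨z, hz, rfl⟩
      refine ⟨fun l => ?_, fun l => ?_⟩
      · rw [key]; have := mul_nonneg hr0.le (hz l); have := ha l; linarith
      · rw [key]; have := mul_nonneg hr0.le (hz l); linarith
  rw [himg, measureReal_def, Set.image_add_right, measure_preimage_add_right]
  change (μ (r • convexHull ℝ (range b))).toReal = _
  rw [Measure.addHaar_smul, ENNReal.toReal_mul, ENNReal.toReal_ofReal (abs_nonneg _),
    abs_of_pos (pow_pos hr0 _), measureReal_def]

end AffineBasis

/-! ### Null hyperplanes -/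

section Null

variable {F : Type*} [NormedAddCommGroup F] [NormedSpace ℝ F] [FiniteDimensional ℝ F]
  [MeasurableSpace F] [BorelSpace F] (μ : Measure F) [μ.IsAddHaarMeasure]

theorem measure_affineMap_eq_zero (h : F →ᵃ[ℝ] ℝ) {y₀ : F} (hy₀ : h y₀ ≠ 0) :
    μ {y | h y = 0} = 0 := by
  have := Measure.addHaar_affineSubspace μ ((affineSpan ℝ {(0 : ℝ)}).comap h) (by
    intro htop
    have : y₀ ∈ (affineSpan ℝ {(0 : ℝ)}).comap h := htop ▸ AffineSubspace.mem_top ℝ F y₀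
    simp at this
    exact hy₀ this)
  convert this using 2
  ext y
  simp

theorem measure_affineSpan_eq_zero_of_card_le {s : Finset F} (hs : s.card ≤ Module.finrank ℝ F) :
    μ (affineSpan ℝ (s : Set F)) = 0 := by
  apply Measure.addHaar_affineSubspace
  intro htop
  rcases s.eq_empty_or_nonempty with rfl | hne
  · have := congrArg (fun t : AffineSubspace ℝ F => (t : Set F)) htop
    simp at this
    exact (Set.empty_ne_univ this)
  · classical
    have h1 := finrank_vectorSpan_image_finset_le ℝ (id : F → F) s
      (n := s.card - 1) (by have := hne.card_pos; omega)
    have h2 : vectorSpan ℝ (s : Set F) = ⊤ := by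
      rw [← direction_affineSpan, htop, AffineSubspace.direction_top]
    have h3 : ((s.image (id : F → F) : Finset F) : Set F) = s := by simp
    rw [h3, h2, finrank_top] at h1
    have := hne.card_pos
    omega

end Null

/-! ### Slabs of a simplex -/

/-- The half-open slab between the level sets `0` and `ε` of the affine function `h`. -/
def slab {F : Type*} [NormedAddCommGroup F] [NormedSpace ℝ F] (h : F →ᵃ[ℝ] ℝ) (ε : ℝ) : Set F :=
  {y | 0 ≤ h y ∧ h y < ε}

/-- For an affine function `h` on an `n`-dimensional simplex `S` with positive vertices `A`, negative
vertices `B` and all others at height zero, the derivative at `ε = 0⁺` of the relative volume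
`vol (S ∩ {0 ≤ h < ε}) / vol S`, as a function of the heights of the vertices. The two lists are
assumed disjoint and free of repetitions whenever this function is used. The recursion
cuts the edge from the first positive to the first negative vertex. Only the positive side of
`h = 0` is seen, so the value is zero if there are no positive vertices; if there are several and no
negative ones, then `{h = 0}` meets the simplex in a face of codimension at least two. -/
noncomputable def sectionDensity {ι : Type*} (n : ℕ) : List ι → List ι → (ι → ℝ) → ℝ
  | [], _, _ => 0
  | [i], [], h => n / h i
  | _ :: _ :: _, [], _ => 0
  | i :: A, j :: B, h =>
      (-h j * sectionDensity n A (j :: B) h + h i * sectionDensity n (i :: A) B h) / (h i - h j)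
termination_by A B => A.length + B.length

section Simplex

variable {F : Type*} [NormedAddCommGroup F] [NormedSpace ℝ F] [FiniteDimensional ℝ F]
  {ι : Type*} [Fintype ι] {b : AffineBasis ι ℝ F}

theorem coord_nonneg_of_mem_simplex {y : F} (hy : y ∈ convexHull ℝ (range b)) (l : ι) :
    0 ≤ b.coord l y := by
  rw [b.convexHull_eq_nonneg_coord] at hy
  exact hy l

theorem isCompact_simplex (b : AffineBasis ι ℝ F) : IsCompact (convexHull ℝ (range b)) :=
  (finite_range b).isCompact_convexHull ℝ

theorem continuous_affineMap (h : F →ᵃ[ℝ] ℝ) : Continuous h := h.continuous_of_finiteDimensional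

theorem mem_simplex_replaceVertex_iff [DecidableEq ι] {i j : ι} (hij : i ≠ j) {w : F}
    (hwi : 0 < b.coord i w) (hwl : ∀ l, l ≠ i → l ≠ j → b.coord l w = 0) {y : F}
    (hwj : 0 < b.coord j w) :
    y ∈ convexHull ℝ (range (replaceVertex b i w hwi.ne')) ↔
      y ∈ convexHull ℝ (range b) ∧ b.coord j w * b.coord i y ≤ b.coord i w * b.coord j y := by
  rw [(replaceVertex b i w hwi.ne').convexHull_eq_nonneg_coord, b.convexHull_eq_nonneg_coord]
  simp only [mem_ofPred_eq]
  have hi := coord_eq_replaceVertex_self hwi.ne' y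
  have hj := coord_eq_replaceVertex_of_ne hwi.ne' hij.symm y
  have hl : ∀ l, l ≠ i → l ≠ j → b.coord l y = (replaceVertex b i w hwi.ne').coord l y := by
    intro l hli hlj
    rw [coord_eq_replaceVertex_of_ne hwi.ne' hli y, hwl l hli hlj]; ring
  set u := fun l => (replaceVertex b i w hwi.ne').coord l y with hu
  change (∀ l, 0 ≤ u l) ↔ _
  change b.coord i y = u i * _ at hi
  change b.coord j y = u j + u i * _ at hj
  change ∀ l, l ≠ i → l ≠ j → b.coord l y = u l at hl
  constructor
  · intro h0
    refine ⟨fun l => ?_, ?_⟩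
    · rcases eq_or_ne l i with rfl | hli
      · rw [hi]; exact mul_nonneg (h0 _) hwi.le
      · rcases eq_or_ne l j with rfl | hlj
        · rw [hj]; have := mul_nonneg (h0 i) hwj.le; have := h0 l; linarith
        · rw [hl l hli hlj]; exact h0 l
    · rw [hi, hj]; have := mul_nonneg (h0 j) hwi.le; nlinarith
  · rintro ⟨h0, hle⟩ l
    rcases eq_or_ne l i with rfl | hli
    · have := h0 l
      rw [hi] at this
      exact nonneg_of_mul_nonneg_left this hwi
    · rcases eq_or_ne l j with rfl | hlj
      · rw [hi, hj] at hle
        have : 0 ≤ b.coord i w * u l := by nlinarith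
        exact nonneg_of_mul_nonneg_right this hwi
      · rw [← hl l hli hlj]; exact h0 l

variable [MeasurableSpace F] [BorelSpace F] (μ : Measure F) [μ.IsAddHaarMeasure]

theorem measure_simplex_inter_ne_top (b : AffineBasis ι ℝ F) (M : Set F) :
    μ (convexHull ℝ (range b) ∩ M) ≠ ⊤ :=
  ne_top_of_le_ne_top (isCompact_simplex b).measure_lt_top.ne (measure_mono inter_subset_left)

theorem measurableSet_slab (h : F →ᵃ[ℝ] ℝ) (ε : ℝ) : MeasurableSet (slab h ε) :=
  (measurableSet_le measurable_const (continuous_affineMap h).measurable).inter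
    (measurableSet_lt (continuous_affineMap h).measurable measurable_const)

/-- A point `w` in the relative interior of the edge from `b i` to `b j` splits the simplex into
two simplices. -/
theorem measure_simplex_split [DecidableEq ι] {i j : ι} (hij : i ≠ j) {w : F}
    (hwi : 0 < b.coord i w) (hwj : 0 < b.coord j w)
    (hwl : ∀ l, l ≠ i → l ≠ j → b.coord l w = 0) {M : Set F} (hM : MeasurableSet M) :
    μ.real (convexHull ℝ (range b) ∩ M) =
      μ.real (convexHull ℝ (range (replaceVertex b i w hwi.ne')) ∩ M) +
      μ.real (convexHull ℝ (range (replaceVertex b j w hwj.ne')) ∩ M) := by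
  have h1 := fun y => mem_simplex_replaceVertex_iff (b := b) hij hwi hwl (y := y) hwj
  have h2 := fun y => mem_simplex_replaceVertex_iff (b := b) hij.symm hwj
    (fun l hj hi => hwl l hi hj) (y := y) hwi
  have hU : convexHull ℝ (range b) ∩ M =
      (convexHull ℝ (range (replaceVertex b i w hwi.ne')) ∩ M) ∪
      (convexHull ℝ (range (replaceVertex b j w hwj.ne')) ∩ M) := by
    rw [← union_inter_distrib_right]
    congr 1
    ext y
    rw [mem_union, h1, h2, ← and_or_left]
    exact (and_iff_left (le_total _ _)).symm
  have hnull : AEDisjoint μ (convexHull ℝ (range (replaceVertex b i w hwi.ne')) ∩ M)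
      (convexHull ℝ (range (replaceVertex b j w hwj.ne')) ∩ M) := by
    let g : F →ᵃ[ℝ] ℝ := b.coord j w • b.coord i - b.coord i w • b.coord j
    refine measure_mono_null ?_ (measure_affineMap_eq_zero μ g (y₀ := b i) ?_)
    · rintro y ⟨⟨hy1, -⟩, ⟨hy2, -⟩⟩
      have := ((h1 y).1 hy1).2
      have := ((h2 y).1 hy2).2
      simp only [g, mem_ofPred_eq, AffineMap.coe_sub, AffineMap.coe_smul, Pi.sub_apply,
        Pi.smul_apply, smul_eq_mul]
      linarith
    · simp only [g, AffineMap.coe_sub, AffineMap.coe_smul, Pi.sub_apply, Pi.smul_apply,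
        smul_eq_mul, b.coord_apply_eq, b.coord_apply_ne hij.symm]
      simpa using hwj.ne'
  rw [hU]
  exact measureReal_union₀ (((isCompact_simplex _).measurableSet.inter hM).nullMeasurableSet) hnull
    (measure_simplex_inter_ne_top _ _ _) (measure_simplex_inter_ne_top _ _ _)

/-- If `h` is nonpositive on the vertices, the slabs meet the simplex in a null set. -/
theorem measure_simplex_slab_of_nonpos {h : F →ᵃ[ℝ] ℝ} {y₀ : F} (hy₀ : h y₀ ≠ 0)
    (hb : ∀ i, h (b i) ≤ 0) (ε : ℝ) : μ.real (convexHull ℝ (range b) ∩ slab h ε) = 0 := by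
  rw [measureReal_def, measure_mono_null ?_ (measure_affineMap_eq_zero μ h hy₀), ENNReal.toReal_zero]
  rintro y ⟨hy, hy0, -⟩
  refine le_antisymm ?_ hy0
  rw [affineMap_eq_sum_coord b h y]
  exact Finset.sum_nonpos fun i _ =>
    mul_nonpos_of_nonneg_of_nonpos (coord_nonneg_of_mem_simplex hy i) (hb i)

/-- One vertex at height `h (b i) > 0`, the others at height zero. -/
theorem measure_simplex_slab_of_single {h : F →ᵃ[ℝ] ℝ} {i : ι} (hi : 0 < h (b i))
    (hb : ∀ l, l ≠ i → h (b l) = 0) {ε : ℝ} (hε : 0 < ε) (hε' : ε < h (b i)) :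
    μ.real (convexHull ℝ (range b) ∩ slab h ε) =
      (1 - (1 - ε / h (b i)) ^ Module.finrank ℝ F) * μ.real (convexHull ℝ (range b)) := by
  classical
  have hy : ∀ y, h y = b.coord i y * h (b i) := by
    intro y
    rw [affineMap_eq_sum_coord b h y, Finset.sum_eq_single i]
    · intro l _ hl; rw [hb l hl, mul_zero]
    · simp
  have hsum : ∑ l, (Pi.single i (ε / h (b i)) : ι → ℝ) l = ε / h (b i) := by simp
  have ha : ∀ l, 0 ≤ (Pi.single i (ε / h (b i)) : ι → ℝ) l := by
    intro l
    by_cases hl : l = i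
    · subst hl; simp; positivity
    · simp [hl]
  have h1 := measure_simplex_inter_coord_ge μ b ha (by rw [hsum, div_lt_one hi]; exact hε')
  rw [hsum] at h1
  have hset : convexHull ℝ (range b) ∩ slab h ε = convexHull ℝ (range b) \
      (convexHull ℝ (range b) ∩ {y | ∀ l, (Pi.single i (ε / h (b i)) : ι → ℝ) l ≤ b.coord l y}) := by
    ext y
    simp only [mem_inter_iff, Set.mem_sdiff, mem_ofPred_eq, slab, not_and, not_forall, not_le]
    constructor
    · rintro ⟨hyS, -, hlt⟩
      refine ⟨hyS, fun _ => ⟨i, ?_⟩⟩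
      rw [hy] at hlt
      simpa [lt_div_iff₀ hi] using hlt
    · rintro ⟨hyS, hlt⟩
      obtain ⟨l, hl⟩ := hlt hyS
      refine ⟨hyS, ?_, ?_⟩
      · rw [hy]; exact mul_nonneg (coord_nonneg_of_mem_simplex hyS i) hi.le
      · by_cases hli : l = i
        · subst hli
          rw [hy]
          simpa [lt_div_iff₀ hi] using hl
        · simp only [Pi.single_eq_of_ne hli] at hl
          exact absurd hl (not_lt.2 (coord_nonneg_of_mem_simplex hyS l))
  rw [hset, measureReal_sdiff inter_subset_left
    ((isCompact_simplex b).measurableSet.inter ?_) (isCompact_simplex b).measure_lt_top.ne, h1]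
  · ring
  · rw [ofPred_forall]
    exact MeasurableSet.iInter fun l =>
      measurableSet_le measurable_const (continuous_affineMap _).measurable

/-- Two vertices at heights `h (b i), h (b j) > 0`, the others at height at least zero. -/
theorem measure_simplex_slab_le_of_pair {h : F →ᵃ[ℝ] ℝ} {i j : ι} (hij : i ≠ j) (hi : 0 < h (b i))
    (hj : 0 < h (b j)) (hb : ∀ l, 0 ≤ h (b l)) {ε : ℝ} (hε : 0 < ε)
    (hε' : ε / h (b i) + ε / h (b j) < 1) :
    μ.real (convexHull ℝ (range b) ∩ slab h ε) ≤
      (1 - (1 - ε / h (b i)) ^ Module.finrank ℝ F - (1 - ε / h (b j)) ^ Module.finrank ℝ F +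
        (1 - ε / h (b i) - ε / h (b j)) ^ Module.finrank ℝ F) * μ.real (convexHull ℝ (range b)) := by
  classical
  set p := ε / h (b i) with hp
  set q := ε / h (b j) with hq
  have hp0 : 0 < p := by positivity
  have hq0 : 0 < q := by positivity
  set S := convexHull ℝ (range b) with hS
  have hSm : MeasurableSet S := (isCompact_simplex b).measurableSet
  have hcm : ∀ l (c : ℝ), MeasurableSet {y : F | c ≤ b.coord l y} := fun l c =>
    measurableSet_le measurable_const (continuous_affineMap _).measurable
  have hgen : ∀ a : ι → ℝ, (∀ l, 0 ≤ a l) → ∑ l, a l < 1 → (∀ l, l ≠ i → l ≠ j → a l = 0) →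
      μ.real (S ∩ ({y | a i ≤ b.coord i y} ∩ {y | a j ≤ b.coord j y})) =
        (1 - (a i + a j)) ^ Module.finrank ℝ F * μ.real S := by
    intro a ha hs h0
    have hsum : ∑ l, a l = a i + a j :=
      Finset.sum_eq_add_of_mem i j (Finset.mem_univ _) (Finset.mem_univ _) hij
        fun l _ hl => h0 l hl.1 hl.2
    rw [← hsum, ← measure_simplex_inter_coord_ge μ b ha hs]
    congr 1
    ext y
    simp only [mem_inter_iff, mem_ofPred_eq]
    refine and_congr_right fun hyS => ⟨fun hy l => ?_, fun hy => ⟨hy i, hy j⟩⟩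
    rcases eq_or_ne l i with rfl | hli
    · exact hy.1
    rcases eq_or_ne l j with rfl | hlj
    · exact hy.2
    rw [h0 l hli hlj]; exact coord_nonneg_of_mem_simplex hyS l
  have hgen' : ∀ r s : ℝ, 0 ≤ r → 0 ≤ s → r + s < 1 →
      μ.real (S ∩ ({y | r ≤ b.coord i y} ∩ {y | s ≤ b.coord j y})) =
        (1 - (r + s)) ^ Module.finrank ℝ F * μ.real S := by
    intro r s hr hs hrs
    have := hgen (fun l => if l = i then r else if l = j then s else 0)
      (fun l => by split_ifs <;> first | assumption | exact le_rfl)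
      (by
        rw [Finset.sum_eq_add_of_mem i j (Finset.mem_univ _) (Finset.mem_univ _) hij]
        · simpa [hij.symm] using hrs
        · intro l _ hl; simp [hl.1, hl.2])
      (fun l h1 h2 => by simp [h1, h2])
    simpa [hij.symm] using this
  have hI : μ.real (S ∩ {y | p ≤ b.coord i y}) = (1 - p) ^ Module.finrank ℝ F * μ.real S := by
    have := hgen' p 0 hp0.le le_rfl (by linarith)
    rw [add_zero] at this
    rw [← this]
    congr 1
    ext y
    simp only [mem_inter_iff, mem_ofPred_eq]
    exact ⟨fun hy => ⟨hy.1, hy.2, coord_nonneg_of_mem_simplex hy.1 j⟩, fun hy => ⟨hy.1, hy.2.1⟩⟩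
  have hJ : μ.real (S ∩ {y | q ≤ b.coord j y}) = (1 - q) ^ Module.finrank ℝ F * μ.real S := by
    have := hgen' 0 q le_rfl hq0.le (by linarith)
    rw [zero_add] at this
    rw [← this]
    congr 1
    ext y
    simp only [mem_inter_iff, mem_ofPred_eq]
    exact ⟨fun hy => ⟨hy.1, coord_nonneg_of_mem_simplex hy.1 i, hy.2⟩, fun hy => ⟨hy.1, hy.2.2⟩⟩
  have hIJ := hgen' p q hp0.le hq0.le hε'
  have hsub : S ∩ slab h ε ⊆
      S \ ((S ∩ {y | p ≤ b.coord i y}) ∪ (S ∩ {y | q ≤ b.coord j y})) := by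
    rintro y ⟨hyS, -, hy⟩
    have hle : ∀ l, b.coord l y * h (b l) ≤ h y := by
      intro l
      rw [affineMap_eq_sum_coord b h y]
      exact Finset.single_le_sum (f := fun l => b.coord l y * h (b l))
        (fun l _ => mul_nonneg (coord_nonneg_of_mem_simplex hyS l) (hb l)) (Finset.mem_univ l)
    refine ⟨hyS, ?_⟩
    rintro (⟨-, h1⟩ | ⟨-, h1⟩)
    · have h1 : p ≤ b.coord i y := h1
      rw [hp, div_le_iff₀ hi] at h1
      linarith [hle i]
    · have h1 : q ≤ b.coord j y := h1
      rw [hq, div_le_iff₀ hj] at h1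
      linarith [hle j]
  refine (measureReal_mono hsub (ne_top_of_le_ne_top (isCompact_simplex b).measure_lt_top.ne
    (measure_mono sdiff_subset))).trans_eq ?_
  have hun := measureReal_union_add_inter (μ := μ) (s := S ∩ {y | p ≤ b.coord i y})
    (t := S ∩ {y | q ≤ b.coord j y}) (hSm.inter (hcm j q)) (measure_simplex_inter_ne_top μ b _)
    (measure_simplex_inter_ne_top μ b _)
  rw [← inter_inter_distrib_left, hIJ, hI, hJ] at hun
  rw [measureReal_sdiff (union_subset inter_subset_left inter_subset_left)
    ((hSm.inter (hcm i p)).union (hSm.inter (hcm j q)))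
    (isCompact_simplex b).measure_lt_top.ne, eq_sub_of_add_eq hun]
  ring

theorem tendsto_div_of_hasDerivAt {f : ℝ → ℝ} {f' : ℝ} (hf : HasDerivAt f f' 0) (h0 : f 0 = 0) :
    Tendsto (fun ε => f ε / ε) (𝓝[>] 0) (𝓝 f') := by
  refine hf.tendsto_slope_zero_right.congr fun ε => ?_
  rw [zero_add, h0, sub_zero, smul_eq_mul, inv_mul_eq_div]

theorem hasDerivAt_one_sub_pow (n : ℕ) (c : ℝ) :
    HasDerivAt (fun ε : ℝ => (1 - ε * c) ^ n) (-(n * c)) 0 := by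
  have h1 : HasDerivAt (fun ε : ℝ => 1 - ε * c) (-c) 0 := by
    simpa using ((hasDerivAt_id (0 : ℝ)).mul_const c).const_sub 1
  have := h1.fun_pow n
  simpa using this

/-- `sectionDensity` is the right derivative of the relative volume of the slabs of a simplex. The
heights `k` are only compared with `h` at the vertices in `A ++ B`, since cutting an edge moves a
vertex to height zero without changing `k`. The point `y₀` excludes the case `h = 0`. -/
theorem tendsto_measure_simplex_slab [DecidableEq ι] {h : F →ᵃ[ℝ] ℝ} {y₀ : F} (hy₀ : h y₀ ≠ 0)
    {k : ι → ℝ} : ∀ (A B : List ι) (b : AffineBasis ι ℝ F), (A ++ B).Nodup →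
    (∀ i ∈ A, 0 < k i) → (∀ i ∈ B, k i < 0) → (∀ i ∈ A ++ B, h (b i) = k i) →
    (∀ i, i ∉ A ++ B → h (b i) = 0) →
    Tendsto (fun ε => μ.real (convexHull ℝ (range b) ∩ slab h ε) / ε) (𝓝[>] 0)
      (𝓝 (sectionDensity (Module.finrank ℝ F) A B k * μ.real (convexHull ℝ (range b))))
  | [], B, b, _, _, hB, hk, h0 => by
    have hle : ∀ i, h (b i) ≤ 0 := by
      intro i
      by_cases hi : i ∈ B
      · rw [hk i (by simpa using hi)]; exact (hB i hi).le
      · exact (h0 i (by simpa using hi)).le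
    simp [sectionDensity, measure_simplex_slab_of_nonpos μ hy₀ hle]
  | [i], [], b, _, hA, _, hk, h0 => by
    have hki : h (b i) = k i := hk i (by simp)
    have hi : 0 < h (b i) := by rw [hki]; exact hA i (by simp)
    have hb : ∀ l, l ≠ i → h (b l) = 0 := fun l hl => h0 l (by simpa using hl)
    have hd : HasDerivAt (fun ε => (1 - (1 - ε * (k i)⁻¹) ^ Module.finrank ℝ F) *
        μ.real (convexHull ℝ (range b)))
        (-(-(Module.finrank ℝ F * (k i)⁻¹)) * μ.real (convexHull ℝ (range b))) 0 :=
      ((hasDerivAt_one_sub_pow _ _).const_sub 1).mul_const _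
    have := tendsto_div_of_hasDerivAt hd (by simp)
    rw [neg_neg, ← div_eq_mul_inv] at this
    rw [sectionDensity]
    refine this.congr' ?_
    filter_upwards [Ioo_mem_nhdsGT hi] with ε hε
    rw [measure_simplex_slab_of_single μ hi hb hε.1 hε.2, hki, div_eq_mul_inv ε (k i)]
  | i :: j :: A, [], b, hnd, hA, _, hk, h0 => by
    have hij : i ≠ j := by
      rintro rfl
      simp at hnd
    have hki : h (b i) = k i := hk i (by simp)
    have hkj : h (b j) = k j := hk j (by simp)
    have hi : 0 < k i := hA i (by simp)
    have hj : 0 < k j := hA j (by simp)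
    have hb : ∀ l, 0 ≤ h (b l) := by
      intro l
      by_cases hl : l ∈ i :: j :: A
      · rw [hk l (by simpa using hl)]; exact (hA l hl).le
      · exact (h0 l (by simpa using hl)).ge
    have hd : HasDerivAt (fun ε => (1 - (1 - ε * (k i)⁻¹) ^ Module.finrank ℝ F -
        (1 - ε * (k j)⁻¹) ^ Module.finrank ℝ F +
        (1 - ε * ((k i)⁻¹ + (k j)⁻¹)) ^ Module.finrank ℝ F) * μ.real (convexHull ℝ (range b)))
        ((-(-(Module.finrank ℝ F * (k i)⁻¹)) - -(Module.finrank ℝ F * (k j)⁻¹) +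
          -(Module.finrank ℝ F * ((k i)⁻¹ + (k j)⁻¹))) * μ.real (convexHull ℝ (range b))) 0 :=
      ((((hasDerivAt_one_sub_pow _ _).const_sub 1).sub (hasDerivAt_one_sub_pow _ _)).add
        (hasDerivAt_one_sub_pow _ _)).mul_const _
    have hlim := tendsto_div_of_hasDerivAt hd (by simp)
    have h00 : (-(-(Module.finrank ℝ F * (k i)⁻¹)) - -(Module.finrank ℝ F * (k j)⁻¹) +
          -(Module.finrank ℝ F * ((k i)⁻¹ + (k j)⁻¹))) = 0 := by ring
    rw [h00, zero_mul] at hlim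
    rw [sectionDensity, zero_mul]
    have hpos : 0 < ((k i)⁻¹ + (k j)⁻¹)⁻¹ := by positivity
    refine tendsto_of_tendsto_of_tendsto_of_le_of_le' tendsto_const_nhds hlim ?_ ?_
    · filter_upwards [self_mem_nhdsWithin] with ε (hε : 0 < ε)
      positivity
    · filter_upwards [Ioo_mem_nhdsGT hpos] with ε hε
      have h1 : ε / h (b i) + ε / h (b j) < 1 := by
        rw [hki, hkj, div_eq_mul_inv, div_eq_mul_inv, ← mul_add]
        have := hε.2
        rwa [← one_div, lt_div_iff₀ (by positivity)] at this
      refine div_le_div_of_nonneg_right ?_ hε.1.le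
      refine (measure_simplex_slab_le_of_pair μ hij (hki ▸ hi) (hkj ▸ hj) hb hε.1 h1).trans_eq ?_
      rw [hki, hkj, div_eq_mul_inv, div_eq_mul_inv, mul_add, sub_sub 1 (ε * _)]
  | i :: A, j :: B, b, hnd, hA, hB, hk, h0 => by
    have hi : 0 < k i := hA i (by simp)
    have hj : k j < 0 := hB j (by simp)
    have hij : i ≠ j := by
      rintro rfl
      exact absurd hi hj.not_gt
    have hki : h (b i) = k i := hk i (by simp)
    have hkj : h (b j) = k j := hk j (by simp)
    have hD : 0 < k i - k j := by linarith
    -- the point of the edge from `b i` to `b j` where `h` vanishes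
    set w : F := AffineMap.lineMap (b i) (b j) (k i / (k i - k j)) with hw
    have hline : ∀ g : F →ᵃ[ℝ] ℝ,
        g w = (-k j / (k i - k j)) * g (b i) + (k i / (k i - k j)) * g (b j) := by
      intro g
      rw [hw, AffineMap.apply_lineMap, AffineMap.lineMap_apply_ring]
      field_simp
      ring
    have hwi : b.coord i w = -k j / (k i - k j) := by
      rw [hline, b.coord_apply_eq, b.coord_apply_ne hij]; ring
    have hwj : b.coord j w = k i / (k i - k j) := by
      rw [hline, b.coord_apply_eq, b.coord_apply_ne hij.symm]; ring
    have hwl : ∀ l, l ≠ i → l ≠ j → b.coord l w = 0 := by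
      intro l hli hlj
      rw [hline, b.coord_apply_ne hli, b.coord_apply_ne hlj]; ring
    have hhw : h w = 0 := by
      rw [hline, hki, hkj]; ring
    have hwi0 : 0 < b.coord i w := by rw [hwi]; exact div_pos (by linarith) hD
    have hwj0 : 0 < b.coord j w := by rw [hwj]; exact div_pos hi hD
    have hnd1 : (A ++ j :: B).Nodup := (List.nodup_cons.1 hnd).2
    have hiA : i ∉ A ++ j :: B := (List.nodup_cons.1 hnd).1
    have hperm : (i :: A ++ j :: B).Perm (j :: (i :: A ++ B)) := List.perm_middle
    have hnd' := hperm.nodup_iff.1 hnd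
    have hnd2 : (i :: A ++ B).Nodup := (List.nodup_cons.1 hnd').2
    have hjA : j ∉ i :: A ++ B := (List.nodup_cons.1 hnd').1
    have hmem : ∀ l, l ∈ i :: A ++ j :: B ↔ l = j ∨ l ∈ i :: A ++ B := fun l => by
      rw [hperm.mem_iff, List.mem_cons]
    have ih1 := tendsto_measure_simplex_slab hy₀ A (j :: B) (replaceVertex b i w hwi0.ne') hnd1
      (fun l hl => hA l (List.mem_cons_of_mem _ hl)) hB
      (fun l hl => by
        have hli : l ≠ i := fun e => hiA (e ▸ hl)
        rw [coe_replaceVertex, Function.update_of_ne hli]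
        exact hk l (List.mem_cons_of_mem _ hl))
      (fun l hl => by
        rw [coe_replaceVertex]
        rcases eq_or_ne l i with rfl | hli
        · rw [Function.update_self]; exact hhw
        · rw [Function.update_of_ne hli]
          exact h0 l fun hl' => (List.mem_cons.1 hl').elim hli hl)
    have ih2 := tendsto_measure_simplex_slab hy₀ (i :: A) B (replaceVertex b j w hwj0.ne') hnd2
      hA (fun l hl => hB l (List.mem_cons_of_mem _ hl))
      (fun l hl => by
        have hli : l ≠ j := fun e => hjA (e ▸ hl)
        rw [coe_replaceVertex, Function.update_of_ne hli]
        exact hk l ((hmem l).2 (Or.inr hl)))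
      (fun l hl => by
        rw [coe_replaceVertex]
        rcases eq_or_ne l j with rfl | hli
        · rw [Function.update_self]; exact hhw
        · rw [Function.update_of_ne hli]
          exact h0 l fun hl' => ((hmem l).1 hl').elim hli hl)
    have hsum := ih1.add ih2
    rw [measure_simplex_replaceVertex, measure_simplex_replaceVertex, abs_of_pos hwi0,
      abs_of_pos hwj0] at hsum
    have hval : sectionDensity (Module.finrank ℝ F) (i :: A) (j :: B) k *
        μ.real (convexHull ℝ (range b)) =
        sectionDensity (Module.finrank ℝ F) A (j :: B) k *
          (b.coord i w * μ.real (convexHull ℝ (range b))) +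
        sectionDensity (Module.finrank ℝ F) (i :: A) B k *
          (b.coord j w * μ.real (convexHull ℝ (range b))) := by
      rw [sectionDensity, hwi, hwj]; ring
    rw [hval]
    refine hsum.congr fun ε => ?_
    rw [measure_simplex_split μ hij hwi0 hwj0 hwl (measurableSet_slab h ε), add_div]
termination_by A B => A.length + B.length

end Simplex

/-! ### Triangulation of a polytope -/

section Triangulation

variable {F : Type*} [NormedAddCommGroup F] [NormedSpace ℝ F] [FiniteDimensional ℝ F]
  {ι : Type*} [Fintype ι]

/-- The affine function interpolating `ω` at the points of the affine basis `b`. -/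
noncomputable def interpolant (ω : F → ℝ) (b : AffineBasis ι ℝ F) : F →ᵃ[ℝ] ℝ :=
  ∑ i, ω (b i) • b.coord i

theorem interpolant_apply (ω : F → ℝ) (b : AffineBasis ι ℝ F) (y : F) :
    interpolant ω b y = ∑ i, b.coord i y * ω (b i) := by
  have : ∀ s : Finset ι, (∑ i ∈ s, ω (b i) • b.coord i : F →ᵃ[ℝ] ℝ) y =
      ∑ i ∈ s, b.coord i y * ω (b i) := by
    classical
    intro s
    induction s using Finset.induction_on with
    | empty => simp
    | insert a s ha ih => simp [Finset.sum_insert ha, ih, mul_comm]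
  exact this _

theorem interpolant_apply_basis (ω : F → ℝ) (b : AffineBasis ι ℝ F) (i : ι) :
    interpolant ω b (b i) = ω (b i) := by
  classical
  simp [interpolant_apply, b.coord_apply]

/-- The simplex spanned by `b` lies in the lower boundary of the convex hull of `V` lifted by the
height function `ω`, and no other point of `V` is lifted to its supporting hyperplane. -/
def IsLowerFace (V : Finset F) (ω : F → ℝ) (b : AffineBasis ι ℝ F) : Prop :=
  range b ⊆ V ∧ ∀ v ∈ V, v ∉ range b → interpolant ω b v < ω v

theorem finite_setOf_range_subset (V : Finset F) :
    {b : AffineBasis ι ℝ F | range b ⊆ V}.Finite := by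
  have h : (Set.univ.pi fun _ : ι => (V : Set F)).Finite := Set.Finite.pi fun _ => V.finite_toSet
  refine (h.preimage (f := fun b : AffineBasis ι ℝ F => (b : ι → F))
    DFunLike.coe_injective.injOn).subset ?_
  intro b hb i _
  exact hb (mem_range_self i)

/-- Each forbidden coincidence is the zero set of a nonzero linear functional of `ω`, and finitely
many hyperplanes do not cover the space of heights. -/
theorem exists_generic_height (V : Finset F) : ∃ ω : F → ℝ, ∀ b : AffineBasis ι ℝ F,
    range b ⊆ V → ∀ v ∈ V, v ∉ range b → interpolant ω b v ≠ ω v := by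
  classical
  let I := {p : AffineBasis ι ℝ F × F | (range p.1 ⊆ V ∧ p.2 ∈ V) ∧ p.2 ∉ range p.1}
  have hI : I.Finite := by
    refine ((finite_setOf_range_subset (ι := ι) V).prod V.finite_toSet).subset ?_
    rintro ⟨b, v⟩ ⟨⟨h1, h2⟩, -⟩
    exact ⟨h1, h2⟩
  have := hI.to_subtype
  let f : I → Module.Dual ℝ (F → ℝ) := fun p =>
    LinearMap.proj p.1.2 - ∑ i, p.1.1.coord i p.1.2 • LinearMap.proj (p.1.1 i)
  have hf : ∀ (p : I) (ω : F → ℝ), f p ω = ω p.1.2 - interpolant ω p.1.1 p.1.2 := by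
    intro p ω
    simp [f, interpolant_apply, LinearMap.sum_apply]
  obtain ⟨ω, hω⟩ := Module.Dual.exists_forall_ne_zero_of_forall_exists f (by
    intro p
    refine ⟨Pi.single p.1.2 1, ?_⟩
    rw [hf, interpolant_apply, Finset.sum_eq_zero]
    · simp
    · intro i _
      rw [Pi.single_eq_of_ne, mul_zero]
      intro h
      exact p.2.2 ⟨i, h⟩)
  refine ⟨ω, fun b hb v hv hvb h => hω ⟨(b, v), ⟨hb, hv⟩, hvb⟩ ?_⟩
  rw [hf]
  exact sub_eq_zero.2 h.symm

/-- The points that are not in general position with respect to `V`: those on the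
affine span of a subset of `V` with at most `dim F` elements, or on a facet hyperplane of a simplex
with vertices in `V`. -/
def degeneratePoints (ι : Type*) [Fintype ι] (V : Finset F) : Set F :=
  (⋃ s ∈ {s : Finset F | s ⊆ V ∧ s.card ≤ Module.finrank ℝ F}, (affineSpan ℝ (s : Set F) : Set F)) ∪
    ⋃ b ∈ {b : AffineBasis ι ℝ F | range b ⊆ V}, ⋃ i, {y | b.coord i y = 0}

theorem interpolant_le_of_isLowerFace {V : Finset F} {ω : F → ℝ} {b : AffineBasis ι ℝ F}
    (hb : IsLowerFace V ω b) {v : F} (hv : v ∈ V) : interpolant ω b v ≤ ω v := by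
  by_cases h : v ∈ range b
  · obtain ⟨i, rfl⟩ := h
    exact (interpolant_apply_basis ω b i).le
  · exact (hb.2 v hv h).le

theorem coord_pos_of_notMem_degeneratePoints {V : Finset F} {b : AffineBasis ι ℝ F}
    (hb : range b ⊆ V) {y : F} (hy : y ∉ degeneratePoints ι V)
    (hyb : y ∈ convexHull ℝ (range b)) (i : ι) : 0 < b.coord i y := by
  refine lt_of_le_of_ne (coord_nonneg_of_mem_simplex hyb i) fun h => hy (Or.inr ?_)
  simp only [mem_iUnion]
  exact ⟨b, hb, i, h.symm⟩

theorem interpolant_lt_interpolant {V : Finset F} {ω : F → ℝ} {b b' : AffineBasis ι ℝ F}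
    (hb : IsLowerFace V ω b) (hb' : range b' ⊆ V) {y : F} (hy : y ∉ degeneratePoints ι V)
    (hyb' : y ∈ convexHull ℝ (range b')) (hne : ¬ range b' ⊆ range b) :
    interpolant ω b y < interpolant ω b' y := by
  obtain ⟨_, ⟨l, rfl⟩, hl⟩ := not_subset.1 hne
  rw [affineMap_eq_sum_coord b' (interpolant ω b) y, interpolant_apply]
  refine Finset.sum_lt_sum (fun j _ => ?_) ⟨l, Finset.mem_univ _, ?_⟩
  · exact mul_le_mul_of_nonneg_left
      (interpolant_le_of_isLowerFace hb (hb' (mem_range_self j))) (coord_nonneg_of_mem_simplex hyb' j)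
  · exact mul_lt_mul_of_pos_left (hb.2 _ (hb' (mem_range_self l)) hl)
      (coord_pos_of_notMem_degeneratePoints hb' hy hyb' l)

theorem range_subset_of_range_subset {b b' : AffineBasis ι ℝ F} (h : range b' ⊆ range b) :
    range b ⊆ range b' := by
  refine (Set.eq_of_subset_of_ncard_le h ?_ (finite_range b)).ge
  rw [← Set.image_univ, ← Set.image_univ, ncard_image_of_injective _ b.ind.injective,
    ncard_image_of_injective _ b'.ind.injective]

/-- Two simplices of the lower boundary that share a point in general position coincide: the height
of the lower boundary over that point is attained by a unique simplex. -/
theorem range_eq_of_isLowerFace {V : Finset F} {ω : F → ℝ} {b b' : AffineBasis ι ℝ F}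
    (hb : IsLowerFace V ω b) (hb' : IsLowerFace V ω b') {y : F} (hy : y ∉ degeneratePoints ι V)
    (hyb : y ∈ convexHull ℝ (range b)) (hyb' : y ∈ convexHull ℝ (range b')) :
    range b = range b' := by
  by_contra hne
  have h1 : ¬ range b' ⊆ range b := fun h =>
    hne ((range_subset_of_range_subset h).antisymm h)
  have h2 : ¬ range b ⊆ range b' := fun h =>
    hne (h.antisymm (range_subset_of_range_subset h))
  exact lt_asymm (interpolant_lt_interpolant hb hb'.1 hy hyb' h1)
    (interpolant_lt_interpolant hb' hb.1 hy hyb h2)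

/-- One step of the simplex algorithm: a point `v` lifted below the interpolant of `b` can replace
a point of `b` so that the new simplex contains `y` and has a lower interpolant at `y`. -/
theorem exists_lower_simplex {V : Finset F} {ω : F → ℝ} {b : AffineBasis ι ℝ F}
    (hb : range b ⊆ V) {y : F} (hy : y ∉ degeneratePoints ι V) (hyb : y ∈ convexHull ℝ (range b))
    {v : F} (hv : v ∈ V) (hlt : ω v < interpolant ω b v) :
    ∃ b' : AffineBasis ι ℝ F, range b' ⊆ V ∧ y ∈ convexHull ℝ (range b') ∧
      interpolant ω b' y < interpolant ω b y := by
  classical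
  have hne : (Finset.univ.filter fun i => 0 < b.coord i v).Nonempty := by
    by_contra h
    rw [Finset.not_nonempty_iff_eq_empty, Finset.filter_eq_empty_iff] at h
    have h1 := b.sum_coord_apply_eq_one v
    have h2 : ∑ i, b.coord i v ≤ 0 := Finset.sum_nonpos fun i hi => not_lt.1 (h hi)
    linarith
  obtain ⟨i, hi, hmin⟩ := Finset.exists_min_image _ (fun i => b.coord i y / b.coord i v) hne
  have hi0 : 0 < b.coord i v := (Finset.mem_filter.1 hi).2
  have hpos := coord_pos_of_notMem_degeneratePoints hb hy hyb
  have hself := coord_eq_replaceVertex_self hi0.ne' y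
  have hother := fun j (hj : j ≠ i) => coord_eq_replaceVertex_of_ne hi0.ne' hj y
  set b' := replaceVertex b i v hi0.ne' with hb'
  have hθ : b'.coord i y = b.coord i y / b.coord i v := by
    rw [eq_div_iff hi0.ne']; exact hself.symm
  have hθ0 : 0 < b'.coord i y := by rw [hθ]; exact div_pos (hpos i) hi0
  refine ⟨b', ?_, ?_, ?_⟩
  · rintro _ ⟨j, rfl⟩
    rw [hb', coe_replaceVertex]
    rcases eq_or_ne j i with rfl | hj
    · rw [Function.update_self]; exact hv
    · rw [Function.update_of_ne hj]; exact hb (mem_range_self j)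
  · rw [b'.convexHull_eq_nonneg_coord]
    intro j
    rcases eq_or_ne j i with rfl | hj
    · exact hθ0.le
    · have h1 := hother j hj
      rcases lt_or_ge 0 (b.coord j v) with hc | hc
      · have h2 := hmin j (Finset.mem_filter.2 ⟨Finset.mem_univ _, hc⟩)
        rw [← hθ, le_div_iff₀ hc] at h2
        linarith
      · have h2 := mul_nonpos_of_nonneg_of_nonpos hθ0.le hc
        have h3 := hpos j
        linarith
  · rw [affineMap_eq_sum_coord b' (interpolant ω b) y, interpolant_apply]
    refine Finset.sum_lt_sum (fun j _ => ?_) ⟨i, Finset.mem_univ _, ?_⟩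
    · rcases eq_or_ne j i with rfl | hj
      · rw [hb', coe_replaceVertex, Function.update_self, ← hb']
        exact mul_le_mul_of_nonneg_left hlt.le hθ0.le
      · rw [hb', coe_replaceVertex, Function.update_of_ne hj, interpolant_apply_basis]
    · rw [hb', coe_replaceVertex, Function.update_self, ← hb']
      exact mul_lt_mul_of_pos_left hlt hθ0

theorem exists_simplex_of_mem_convexHull {V : Finset F} {y : F}
    (hy : y ∉ degeneratePoints (Fin (Module.finrank ℝ F + 1)) V)
    (hyV : y ∈ convexHull ℝ (V : Set F)) :
    ∃ b : AffineBasis (Fin (Module.finrank ℝ F + 1)) ℝ F,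
      range b ⊆ V ∧ y ∈ convexHull ℝ (range b) := by
  classical
  rw [convexHull_eq_union] at hyV
  simp only [mem_iUnion] at hyV
  obtain ⟨s, hsV, hs, hys⟩ := hyV
  have hcard : s.card = Module.finrank ℝ F + 1 := by
    refine le_antisymm ?_ ?_
    · have := hs.card_le_finrank_succ
      rw [Fintype.card_coe] at this
      exact this.trans (Nat.succ_le_succ (Submodule.finrank_le _))
    · by_contra! hlt
      refine hy (Or.inl ?_)
      simp only [mem_iUnion]
      exact ⟨s, ⟨by exact_mod_cast hsV, by omega⟩, convexHull_subset_affineSpan _ hys⟩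
  let e : Fin (Module.finrank ℝ F + 1) ≃ s := (s.equivFinOfCardEq hcard).symm
  have hind : AffineIndependent ℝ (fun i => (e i : F)) := hs.comp_embedding e.toEmbedding
  have hrange : range (fun i => (e i : F)) = s := by
    rw [range_comp' Subtype.val e, e.range_eq_univ, image_univ, Subtype.range_coe]
  refine ⟨⟨fun i => e i, hind, (hind.affineSpan_eq_top_iff_card_eq_finrank_add_one).2 (by simp)⟩,
    ?_, ?_⟩
  · change range (fun i => (e i : F)) ⊆ _
    rw [hrange]; exact hsV
  · change y ∈ convexHull ℝ (range (fun i => (e i : F)))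
    rw [hrange]; exact hys

/-- The simplices of the lower boundary cover all points in general position: among the simplices
containing `y`, the one of least height over `y` belongs to the lower boundary. -/
theorem exists_isLowerFace {V : Finset F} {ω : F → ℝ}
    (hω : ∀ b : AffineBasis (Fin (Module.finrank ℝ F + 1)) ℝ F,
      range b ⊆ V → ∀ v ∈ V, v ∉ range b → interpolant ω b v ≠ ω v) {y : F}
    (hy : y ∉ degeneratePoints (Fin (Module.finrank ℝ F + 1)) V)
    (hyV : y ∈ convexHull ℝ (V : Set F)) :
    ∃ b : AffineBasis (Fin (Module.finrank ℝ F + 1)) ℝ F,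
      IsLowerFace V ω b ∧ y ∈ convexHull ℝ (range b) := by
  have hfin : {b : AffineBasis (Fin (Module.finrank ℝ F + 1)) ℝ F |
      range b ⊆ V ∧ y ∈ convexHull ℝ (range b)}.Finite :=
    (finite_setOf_range_subset V).subset fun b hb => hb.1
  obtain ⟨b, hb, hmin⟩ := Set.exists_min_image _ (fun b => interpolant ω b y) hfin
    (exists_simplex_of_mem_convexHull hy hyV)
  refine ⟨b, ⟨hb.1, fun v hv hvb => ?_⟩, hb.2⟩
  by_contra! hle
  obtain ⟨b', h1, h2, h3⟩ := exists_lower_simplex hb.1 hy hb.2 hv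
    (lt_of_le_of_ne hle (hω b hb.1 v hv hvb).symm)
  exact absurd (hmin b' ⟨h1, h2⟩) (not_le.2 h3)

variable [MeasurableSpace F] [BorelSpace F] (μ : Measure F) [μ.IsAddHaarMeasure]

theorem measure_degeneratePoints (V : Finset F) : μ (degeneratePoints ι V) = 0 := by
  refine measure_union_null ?_ ?_
  · refine (measure_biUnion_null_iff ?_).2 fun s hs => measure_affineSpan_eq_zero_of_card_le μ hs.2
    exact (V.powerset.finite_toSet.subset fun s hs => by simpa using hs.1).countable
  · refine (measure_biUnion_null_iff (finite_setOf_range_subset V).countable).2 fun b _ => ?_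
    refine measure_iUnion_null fun i => measure_affineMap_eq_zero μ (b.coord i) (y₀ := b i) ?_
    simp

/-- A polytope is, up to a null set, the disjoint union of finitely many simplices whose vertices
are among its vertices. -/
theorem exists_triangulation (V : Finset F) :
    ∃ T : Finset (AffineBasis (Fin (Module.finrank ℝ F + 1)) ℝ F), (∀ b ∈ T, range b ⊆ V) ∧
      ∀ M : Set F, MeasurableSet M → μ.real (convexHull ℝ (V : Set F) ∩ M) =
        ∑ b ∈ T, μ.real (convexHull ℝ (range b) ∩ M) := by
  obtain ⟨ω, hω⟩ := exists_generic_height (ι := Fin (Module.finrank ℝ F + 1)) V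
  let T₀ := {b : AffineBasis (Fin (Module.finrank ℝ F + 1)) ℝ F | IsLowerFace V ω b}
  -- reorderings of the same vertices give different bases: keep one of each
  obtain ⟨T₁, hT₁, hbij⟩ := (surjOn_image (fun b : AffineBasis _ ℝ F => range b) T₀).exists_bijOn_subset
  have hfin : T₁.Finite := (finite_setOf_range_subset V).subset fun b hb => (hT₁ hb).1
  refine ⟨hfin.toFinset, fun b hb => (hT₁ (hfin.mem_toFinset.1 hb)).1, fun M hM => ?_⟩
  have hN := measure_degeneratePoints (ι := Fin (Module.finrank ℝ F + 1)) μ V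
  have hae : (convexHull ℝ (V : Set F) ∩ M : Set F) =ᵐ[μ]
      (⋃ b ∈ hfin.toFinset, (convexHull ℝ (range b) ∩ M) : Set F) := by
    have hN' : ∀ᵐ y ∂μ, y ∉ degeneratePoints (Fin (Module.finrank ℝ F + 1)) V :=
      measure_eq_zero_iff_ae_notMem.1 hN
    filter_upwards [hN'] with y hy
    refine propext (?_ : y ∈ convexHull ℝ (V : Set F) ∩ M ↔
      y ∈ ⋃ b ∈ hfin.toFinset, (convexHull ℝ (range b) ∩ M))
    simp only [mem_iUnion, hfin.mem_toFinset, mem_inter_iff, exists_prop]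
    constructor
    · rintro ⟨hyV, hyM⟩
      obtain ⟨b, hb, hyb⟩ := exists_isLowerFace hω hy hyV
      obtain ⟨b', hb', he⟩ := hbij.surjOn (mem_image_of_mem _ (show b ∈ T₀ from hb))
      have he : range b' = range b := he
      exact ⟨b', hb', by rw [he]; exact hyb, hyM⟩
    · rintro ⟨b, hb, hyb, hyM⟩
      exact ⟨convexHull_mono (hT₁ hb).1 hyb, hyM⟩
  rw [measureReal_def, measure_congr hae, measure_biUnion_finset₀, ENNReal.toReal_sum]
  · rfl
  · intro b _; exact measure_simplex_inter_ne_top μ b M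
  · intro b hb b' hb' hne
    refine measure_mono_null ?_ hN
    rintro y ⟨⟨hyb, -⟩, hyb', -⟩
    by_contra hy
    rw [Finset.mem_coe, hfin.mem_toFinset] at hb hb'
    exact hne (hbij.injOn hb hb' (range_eq_of_isLowerFace (hT₁ hb) (hT₁ hb') hy hyb hyb'))
  · intro b _
    exact ((isCompact_simplex b).measurableSet.inter hM).nullMeasurableSet

end Triangulation

/-! ### Parallel sections of a convex body -/

section Slices

variable {F : Type*} [NormedAddCommGroup F] [InnerProductSpace ℝ F] [FiniteDimensional ℝ F]
  [MeasurableSpace F] [BorelSpace F]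

/-- The linear functional `⟪x, ·⟫` plus a constant, as an affine map. -/
noncomputable def innerAffine (x : F) (c : ℝ) : F →ᵃ[ℝ] ℝ :=
  (innerₛₗ ℝ x).toAffineMap + AffineMap.const ℝ F c

@[simp] theorem innerAffine_apply (x : F) (c : ℝ) (y : F) :
    innerAffine x c y = inner ℝ x y + c := by
  simp [innerAffine]

theorem finrank_orthogonal_span {x : F} (hx : x ≠ 0) :
    Module.finrank ℝ (ℝ ∙ x)ᗮ = Module.finrank ℝ F - 1 := by
  rw [← (ℝ ∙ x).finrank_add_finrank_orthogonal, finrank_span_singleton hx, Nat.add_sub_cancel_left]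

/-- The slices of `K` orthogonal to `x`, measured by Hausdorff measure in `F` or, after translation,
by Lebesgue measure in the fixed space `x^⊥`. -/
theorem hausdorff_slice (K : Set F) {x : F} (hx : x ≠ 0) (s : ℝ) :
    μHE[Module.finrank ℝ F - 1] (K ∩ AffineSubspace.mk' (s • x +ᵥ (0 : F)) (ℝ ∙ x)ᗮ) =
      volume {z : (ℝ ∙ x)ᗮ | s • x + (z : F) ∈ K} := by
  have hiso : Isometry (fun z : (ℝ ∙ x)ᗮ => s • x + (z : F)) := by
    refine Isometry.of_dist_eq fun z w => ?_
    rw [dist_add_left]; rfl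
  rw [← InnerProductSpace.euclideanHausdorffMeasure_eq_volume, finrank_orthogonal_span hx,
    ← hiso.euclideanHausdorffMeasure_image]
  congr 1
  ext y
  simp only [mem_inter_iff, SetLike.mem_coe, AffineSubspace.mem_mk', vadd_eq_add, add_zero,
    vsub_eq_sub, mem_image, mem_ofPred_eq]
  constructor
  · rintro ⟨hy, hys⟩
    exact ⟨⟨y - s • x, hys⟩, by simpa using hy, by simp⟩
  · rintro ⟨z, hz, rfl⟩
    exact ⟨hz, by simp⟩

theorem inner_smul_add_coe (x : F) (s : ℝ) (z : (ℝ ∙ x)ᗮ) :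
    inner ℝ x (s • x + (z : F)) = s * ‖x‖ ^ 2 := by
  rw [inner_add_right, Submodule.mem_orthogonal_singleton_iff_inner_right.1 z.2, inner_smul_right,
    real_inner_self_eq_norm_sq, add_zero]

theorem volume_slab_eq_lintegral {K : Set F} (hK : MeasurableSet K) {x : F} (hx : x ≠ 0) (ε : ℝ) :
    volume (K ∩ slab (innerAffine x 0) ε) =
      ‖x‖ₑ * ∫⁻ s in Ico 0 (ε / ‖x‖ ^ 2), volume {z : (ℝ ∙ x)ᗮ | s • x + (z : F) ∈ K} := by
  rw [← InnerProductSpace.euclideanHausdorffMeasure_eq_volume (V := F),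
    EuclideanGeometry.euclideanHausdorffMeasure_eq_lintegral (0 : F) hx
      (hK.inter (measurableSet_slab _ ε)), ← lintegral_indicator measurableSet_Ico]
  congr 1
  refine lintegral_congr fun s => ?_
  rw [hausdorff_slice _ hx]
  have hx2 : 0 < ‖x‖ ^ 2 := by positivity
  have hmem : ∀ z : (ℝ ∙ x)ᗮ, s • x + (z : F) ∈ slab (innerAffine x 0) ε ↔
      s ∈ Ico 0 (ε / ‖x‖ ^ 2) := by
    intro z
    simp only [slab, mem_ofPred_eq, innerAffine_apply, inner_smul_add_coe, add_zero, mem_Ico]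
    rw [lt_div_iff₀ hx2, mul_nonneg_iff_of_pos_right hx2]
  by_cases hs : s ∈ Ico 0 (ε / ‖x‖ ^ 2)
  · rw [indicator_of_mem hs]
    congr 1
    ext z
    simp only [mem_ofPred_eq, mem_inter_iff, hmem, hs, and_true]
  · rw [indicator_of_notMem hs]
    have : {z : (ℝ ∙ x)ᗮ | s • x + (z : F) ∈ K ∩ slab (innerAffine x 0) ε} = ∅ := by
      ext z
      simp only [mem_ofPred_eq, mem_inter_iff, hmem, hs, and_false, mem_empty_iff_false]
    rw [this, measure_empty]

/-- If `x^⊥` meets the interior of a convex set `K`, then the relative interior of the section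
`K ∩ x^⊥` lies in the interior of `K`. -/
theorem mem_interior_of_mem_interior_slice {K : Set F} (hK : Convex ℝ K) {x p : F}
    (hp : p ∈ interior K) (hpx : inner ℝ x p = 0) {z : (ℝ ∙ x)ᗮ}
    (hz : z ∈ interior {z : (ℝ ∙ x)ᗮ | (z : F) ∈ K}) : (z : F) ∈ interior K := by
  let p' : (ℝ ∙ x)ᗮ := ⟨p, Submodule.mem_orthogonal_singleton_iff_inner_right.2 hpx⟩
  -- prolong the segment from `p` to `z` slightly beyond `z` inside the slice
  have hcont : Continuous fun r : ℝ => z + r • (z - p') := by fun_prop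
  have hev : ∀ᶠ r in 𝓝 (0 : ℝ), z + r • (z - p') ∈ {z : (ℝ ∙ x)ᗮ | (z : F) ∈ K} := by
    have h0 : Tendsto (fun r : ℝ => z + r • (z - p')) (𝓝 0) (𝓝 z) := by
      simpa using hcont.tendsto 0
    exact h0 (mem_interior_iff_mem_nhds.1 hz)
  obtain ⟨r, hr, hr0⟩ := ((hev.filter_mono nhdsWithin_le_nhds).and
    (self_mem_nhdsWithin (a := (0 : ℝ)) (s := Ioi 0))).exists
  have hr0 : 0 < r := hr0
  have hr : (z : F) + r • ((z : F) - p) ∈ K := by simpa [p'] using hr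
  refine hK.openSegment_interior_closure_subset_interior hp (subset_closure hr) ?_
  refine ⟨r / (1 + r), 1 / (1 + r), by positivity, by positivity,
    by field_simp; ring, ?_⟩
  have h1 : (1 + r) ≠ 0 := by positivity
  have : (1 + r) • (z : F) = r • p + ((z : F) + r • ((z : F) - p)) := by
    rw [smul_sub, add_smul, one_smul]; abel
  rw [div_eq_inv_mul, div_eq_inv_mul, mul_one, mul_smul, ← smul_add, ← this, inv_smul_smul₀ h1]

/-- Continuity at `0` of the volume of parallel sections: off the frontier of the central section,
which is a null set, membership in the slices is eventually constant. -/
theorem tendsto_volume_slice {K : Set F} (hK : Convex ℝ K) (hKc : IsCompact K) {x : F}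
    (h : (∃ p ∈ interior K, inner ℝ x p = 0) ∨ ∀ p ∈ K, inner ℝ x p ≠ 0) :
    Tendsto (fun s : ℝ => volume {z : (ℝ ∙ x)ᗮ | s • x + (z : F) ∈ K}) (𝓝 0)
      (𝓝 (volume {z : (ℝ ∙ x)ᗮ | (z : F) ∈ K})) := by
  set S := {z : (ℝ ∙ x)ᗮ | (z : F) ∈ K} with hS
  have hSc : Convex ℝ S := hK.linear_preimage (ℝ ∙ x)ᗮ.subtype
  have hslice : ∀ s : ℝ, MeasurableSet {z : (ℝ ∙ x)ᗮ | s • x + (z : F) ∈ K} := fun s =>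
    (hKc.isClosed.preimage (by fun_prop : Continuous fun z : (ℝ ∙ x)ᗮ => s • x + (z : F))).measurableSet
  have hSm : MeasurableSet S := by
    have := hslice 0
    simp only [zero_smul, zero_add] at this
    exact this
  obtain ⟨r, hr⟩ := hKc.isBounded.subset_closedBall (0 : F)
  have hbd : ∀ᶠ s in 𝓝 (0 : ℝ), {z : (ℝ ∙ x)ᗮ | s • x + (z : F) ∈ K} ⊆
      Metric.closedBall 0 (r + 1) := by
    have : Tendsto (fun s : ℝ => ‖s • x‖) (𝓝 0) (𝓝 0) := by
      have : Continuous fun s : ℝ => ‖s • x‖ := by fun_prop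
      simpa using this.tendsto 0
    filter_upwards [this.eventually_lt_const one_pos] with s hs z hz
    have h1 := hr hz
    rw [mem_closedBall_zero_iff] at h1 ⊢
    have h2 := norm_sub_le (s • x + (z : F)) (s • x)
    rw [add_sub_cancel_left] at h2
    calc ‖z‖ = ‖(z : F)‖ := rfl
      _ ≤ r + 1 := by linarith
  refine tendsto_measure_of_ae_tendsto_indicator (𝓝 0) hSm hslice
    (measurableSet_closedBall (x := (0 : (ℝ ∙ x)ᗮ)) (ε := r + 1)) measure_closedBall_lt_top.ne hbd ?_
  have hfr : ∀ᵐ z : (ℝ ∙ x)ᗮ, z ∉ frontier S :=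
    measure_eq_zero_iff_ae_notMem.1 (hSc.addHaar_frontier volume)
  filter_upwards [hfr] with z hz
  have hcont : Tendsto (fun s : ℝ => s • x + (z : F)) (𝓝 0) (𝓝 (z : F)) := by
    have : Continuous fun s : ℝ => s • x + (z : F) := by fun_prop
    simpa using this.tendsto 0
  by_cases hzK : z ∈ S
  · have hzi : z ∈ interior S := by
      by_contra hni
      exact hz ⟨subset_closure hzK, hni⟩
    rcases h with ⟨p, hp, hpx⟩ | h
    · have := mem_interior_of_mem_interior_slice hK hp hpx hzi
      filter_upwards [hcont (mem_interior_iff_mem_nhds.1 this)] with s hs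
      exact iff_of_true hs hzK
    · exact absurd (Submodule.mem_orthogonal_singleton_iff_inner_right.1 z.2) (h _ hzK)
  · filter_upwards [hcont (hKc.isClosed.isOpen_compl.mem_nhds hzK)] with s hs
    exact iff_of_false hs hzK

/-- One-sided Lebesgue differentiation at a point of continuity, without measurability of `f`. -/
theorem tendsto_laverage_Ico {f : ℝ → ENNReal} (hf : Tendsto f (𝓝 0) (𝓝 (f 0))) :
    Tendsto (fun δ => (∫⁻ s in Ico 0 δ, f s) / ENNReal.ofReal δ) (𝓝[>] 0) (𝓝 (f 0)) := by
  have key : ∀ {p : ℝ → Prop}, (∀ᶠ s in 𝓝 (0 : ℝ), p s) →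
      ∀ᶠ δ in 𝓝[>] (0 : ℝ), 0 < δ ∧ ∀ s ∈ Ico 0 δ, p s := by
    intro p hp
    obtain ⟨r, hr, hp⟩ := Metric.eventually_nhds_iff.1 hp
    filter_upwards [Ioo_mem_nhdsGT hr] with δ hδ
    refine ⟨hδ.1, fun s hs => hp ?_⟩
    rw [Real.dist_0_eq_abs, abs_of_nonneg hs.1]
    exact hs.2.trans hδ.2
  have hconst : ∀ (c : ENNReal) {δ : ℝ}, 0 < δ →
      (∫⁻ _ in Ico 0 δ, c) / ENNReal.ofReal δ = c := by
    intro c δ hδ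
    rw [lintegral_const, Measure.restrict_apply_univ, Real.volume_Ico, sub_zero]
    exact ENNReal.mul_div_cancel_right (by simpa using hδ) ENNReal.ofReal_ne_top
  rw [tendsto_order]
  constructor
  · intro a ha
    obtain ⟨c, hac, hc⟩ := exists_between ha
    filter_upwards [key (hf.eventually_const_lt hc)] with δ hδ
    refine hac.trans_le ?_
    conv_lhs => rw [← hconst c hδ.1]
    exact ENNReal.div_le_div_right
      (setLIntegral_mono' measurableSet_Ico fun s hs => (hδ.2 s hs).le) _
  · intro a ha
    obtain ⟨c, hc, hac⟩ := exists_between ha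
    filter_upwards [key (hf.eventually_lt_const hc)] with δ hδ
    refine lt_of_le_of_lt ?_ hac
    conv_rhs => rw [← hconst c hδ.1]
    exact ENNReal.div_le_div_right
      (setLIntegral_mono' measurableSet_Ico fun s hs => (hδ.2 s hs).le) _

/-- The normalized volume of a central section is the right derivative of the volume of the slabs.
The alternative in `h` excludes hyperplanes that touch `K` without meeting its interior, where the
volume of parallel sections may jump. -/
theorem tendsto_volume_slab_div {K : Set F} (hK : Convex ℝ K) (hKc : IsCompact K) {x : F}
    (hx : x ≠ 0) (h : (∃ p ∈ interior K, inner ℝ x p = 0) ∨ ∀ p ∈ K, inner ℝ x p ≠ 0) :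
    Tendsto (fun ε => volume.real (K ∩ slab (innerAffine x 0) ε) / ε) (𝓝[>] 0)
      (𝓝 (1 / ‖x‖ * (μHE[Module.finrank ℝ F - 1] (K ∩ {y | inner ℝ x y = 0})).toReal)) := by
  have hx0 : 0 < ‖x‖ := norm_pos_iff.2 hx
  set f : ℝ → ENNReal := fun s => volume {z : (ℝ ∙ x)ᗮ | s • x + (z : F) ∈ K} with hf
  have hf0 : f 0 = volume {z : (ℝ ∙ x)ᗮ | (z : F) ∈ K} := by simp [hf]
  have hperp : μHE[Module.finrank ℝ F - 1] (K ∩ {y | inner ℝ x y = 0}) = f 0 := by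
    rw [hf]
    refine Eq.trans ?_ (hausdorff_slice K hx 0)
    congr 2
    ext y
    simp [AffineSubspace.mem_mk', Submodule.mem_orthogonal_singleton_iff_inner_right]
  have hfin : f 0 ≠ ⊤ := by
    rw [hf0]
    obtain ⟨r, hr⟩ := hKc.isBounded.subset_closedBall (0 : F)
    refine ne_top_of_le_ne_top (measure_closedBall_lt_top (x := (0 : (ℝ ∙ x)ᗮ)) (r := r)).ne
      (measure_mono fun z hz => ?_)
    have := hr hz
    rw [mem_closedBall_zero_iff] at this ⊢
    exact this
  have hlim := tendsto_laverage_Ico (f := f) (hf0 ▸ tendsto_volume_slice hK hKc h)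
  have hscale : Tendsto (fun ε : ℝ => ε / ‖x‖ ^ 2) (𝓝[>] 0) (𝓝[>] 0) := by
    refine tendsto_nhdsWithin_iff.2 ⟨?_, ?_⟩
    · have : Continuous fun ε : ℝ => ε / ‖x‖ ^ 2 := by fun_prop
      simpa using (this.tendsto 0).mono_left nhdsWithin_le_nhds
    · filter_upwards [self_mem_nhdsWithin] with ε (hε : 0 < ε)
      exact div_pos hε (by positivity)
  have h1 := ((ENNReal.tendsto_toReal hfin).comp (hlim.comp hscale)).const_mul (1 / ‖x‖)
  rw [hperp]
  refine h1.congr' ?_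
  filter_upwards [self_mem_nhdsWithin] with ε (hε : 0 < ε)
  have hδ : 0 < ε / ‖x‖ ^ 2 := by positivity
  rw [measureReal_def, volume_slab_eq_lintegral hKc.measurableSet hx, ENNReal.toReal_mul]
  simp only [Function.comp_apply, ENNReal.toReal_div, ENNReal.toReal_ofReal hδ.le, toReal_enorm]
  field_simp
  rfl

/-- A hyperplane through none of the points of `V` cannot touch the convex hull of `V` without
meeting its interior. -/
theorem exists_interior_orthogonal_or_forall_ne {K : Set F} (hK : Convex ℝ K)
    (hint : (interior K).Nonempty) {V : Set F} (hKV : K = convexHull ℝ V) {x : F}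
    (hV : ∀ v ∈ V, inner ℝ x v ≠ 0) :
    (∃ p ∈ interior K, inner ℝ x p = 0) ∨ ∀ p ∈ K, inner ℝ x p ≠ 0 := by
  by_cases hpos : ∀ v ∈ V, 0 < inner ℝ x v
  · right
    intro p hp
    have : convexHull ℝ V ⊆ {y | 0 < inner ℝ x y} :=
      convexHull_min hpos (convex_halfSpace_gt (innerₛₗ ℝ x).isLinear 0)
    exact (this (hKV ▸ hp)).ne'
  by_cases hneg : ∀ v ∈ V, inner ℝ x v < 0
  · right
    intro p hp
    have : convexHull ℝ V ⊆ {y | inner ℝ x y < 0} :=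
      convexHull_min hneg (convex_halfSpace_lt (innerₛₗ ℝ x).isLinear 0)
    exact (this (hKV ▸ hp)).ne
  left
  push Not at hpos hneg
  obtain ⟨v, hv, hv0⟩ := hpos
  obtain ⟨w, hw, hw0⟩ := hneg
  have hcl : ∀ u ∈ V, u ∈ closure (interior K) := fun u hu => by
    rw [hK.closure_interior_eq_closure_of_nonempty_interior hint]
    exact subset_closure (hKV ▸ subset_convexHull ℝ V hu)
  have hc : Continuous fun y : F => (inner ℝ x y : ℝ) := by fun_prop
  obtain ⟨a, ha, haK⟩ := mem_closure_iff.1 (hcl v hv) {y | inner ℝ x y < 0}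
    (isOpen_lt hc continuous_const) (lt_of_le_of_ne hv0 (hV v hv))
  obtain ⟨c, hc', hcK⟩ := mem_closure_iff.1 (hcl w hw) {y | 0 < inner ℝ x y}
    (isOpen_lt continuous_const hc) (lt_of_le_of_ne hw0 (hV w hw).symm)
  obtain ⟨p, hp, hp0⟩ := hK.interior.isPreconnected.intermediate_value haK hcK hc.continuousOn
    ⟨le_of_lt ha, le_of_lt hc'⟩
  exact ⟨p, hp, hp0⟩

end Slices

/-! ### Rationality of the section density -/

section Rational

variable {d : ℕ}

/-- The function `f (x, t)` agrees on `D` with a polynomial in `t` of degree at most `n` whose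
coefficients are rational functions of `x` with a common denominator not vanishing on `D`. -/
def IsRationalOn (n : ℕ) (D : Set (E d × E d)) (f : E d → E d → ℝ) : Prop :=
  ∃ (p : MvPolynomial (Fin d) (MvPolynomial (Fin d) ℝ)) (q : MvPolynomial (Fin d) ℝ),
    p.totalDegree ≤ n ∧ ∀ x t, (x, t) ∈ D → MvPolynomial.eval (fun i => x i) q ≠ 0 ∧
      f x t = evalAt p x t / MvPolynomial.eval (fun i => x i) q

/-- The linear form `⟪x, v⟫` as a polynomial in `x`. -/
noncomputable def linearForm (v : E d) : MvPolynomial (Fin d) ℝ :=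
  ∑ i, MvPolynomial.C (v i) * MvPolynomial.X i

theorem eval_linearForm (v x : E d) :
    MvPolynomial.eval (fun i => x i) (linearForm v) = inner ℝ x v := by
  simp [linearForm, PiLp.inner_apply]

/-- The function `⟪x, v + t⟫` as a polynomial in `x` and `t`. -/
noncomputable def translatedForm (v : E d) : MvPolynomial (Fin d) (MvPolynomial (Fin d) ℝ) :=
  MvPolynomial.C (linearForm v) + ∑ i, MvPolynomial.C (MvPolynomial.X i) * MvPolynomial.X i

theorem evalAt_translatedForm (v x t : E d) :
    evalAt (translatedForm v) x t = inner ℝ x (v + t) := by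
  simp [evalAt, translatedForm, eval_linearForm, inner_add_right, PiLp.inner_apply, mul_comm]

theorem totalDegree_translatedForm_le (v : E d) : (translatedForm v).totalDegree ≤ 1 := by
  refine (MvPolynomial.totalDegree_add _ _).trans (max_le (by simp) ?_)
  refine MvPolynomial.totalDegree_finsetSum_le fun i _ => ?_
  refine (MvPolynomial.totalDegree_mul _ _).trans ?_
  simp

theorem evalAt_add (p q : MvPolynomial (Fin d) (MvPolynomial (Fin d) ℝ)) (x t : E d) :
    evalAt (p + q) x t = evalAt p x t + evalAt q x t := by simp [evalAt]

theorem evalAt_mul (p q : MvPolynomial (Fin d) (MvPolynomial (Fin d) ℝ)) (x t : E d) :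
    evalAt (p * q) x t = evalAt p x t * evalAt q x t := by simp [evalAt]

theorem evalAt_C (p : MvPolynomial (Fin d) ℝ) (x t : E d) :
    evalAt (MvPolynomial.C p) x t = MvPolynomial.eval (fun i => x i) p := by simp [evalAt]

variable {n m : ℕ} {D : Set (E d × E d)} {f g : E d → E d → ℝ}

theorem IsRationalOn.congr (hf : IsRationalOn n D f) (h : ∀ x t, (x, t) ∈ D → g x t = f x t) :
    IsRationalOn n D g := by
  obtain ⟨p, q, hp, H⟩ := hf
  exact ⟨p, q, hp, fun x t hxt => ⟨(H x t hxt).1, (h x t hxt).trans (H x t hxt).2⟩⟩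

theorem isRationalOn_const (c : ℝ) : IsRationalOn n D fun _ _ => c :=
  ⟨MvPolynomial.C (MvPolynomial.C c), 1, by simp, fun x t _ => by simp [evalAt_C]⟩

theorem IsRationalOn.add (hf : IsRationalOn n D f) (hg : IsRationalOn n D g) :
    IsRationalOn n D fun x t => f x t + g x t := by
  obtain ⟨p, q, hp, H⟩ := hf
  obtain ⟨p', q', hp', H'⟩ := hg
  refine ⟨p * MvPolynomial.C q' + p' * MvPolynomial.C q, q * q', ?_, fun x t hxt => ?_⟩
  · refine (MvPolynomial.totalDegree_add _ _).trans (max_le ?_ ?_)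
    · exact (MvPolynomial.totalDegree_mul _ _).trans (by simpa using hp)
    · exact (MvPolynomial.totalDegree_mul _ _).trans (by simpa using hp')
  · have h1 := (H x t hxt).1
    have h2 := (H' x t hxt).1
    refine ⟨by simp [h1, h2], ?_⟩
    change f x t + g x t = _
    rw [(H x t hxt).2, (H' x t hxt).2, evalAt_add, evalAt_mul, evalAt_mul, evalAt_C, evalAt_C,
      map_mul, div_add_div _ _ h1 h2]
    ring

theorem IsRationalOn.mul (hf : IsRationalOn n D f) (hg : IsRationalOn m D g) :
    IsRationalOn (n + m) D fun x t => f x t * g x t := by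
  obtain ⟨p, q, hp, H⟩ := hf
  obtain ⟨p', q', hp', H'⟩ := hg
  refine ⟨p * p', q * q', (MvPolynomial.totalDegree_mul _ _).trans (add_le_add hp hp'),
    fun x t hxt => ?_⟩
  have h1 := (H x t hxt).1
  have h2 := (H' x t hxt).1
  refine ⟨by simp [h1, h2], ?_⟩
  change f x t * g x t = _
  rw [(H x t hxt).2, (H' x t hxt).2, evalAt_mul, map_mul, div_mul_div_comm]

theorem isRationalOn_inner_add (v : E d) : IsRationalOn 1 D fun x t => inner ℝ x (v + t) :=
  ⟨translatedForm v, 1, totalDegree_translatedForm_le v, fun x t _ => by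
    simp [evalAt_translatedForm]⟩

theorem isRationalOn_inv_inner {v : E d} (hv : ∀ x t, (x, t) ∈ D → inner ℝ x v ≠ 0) :
    IsRationalOn 0 D fun x _ => (inner ℝ x v)⁻¹ :=
  ⟨1, linearForm v, by simp, fun x t hxt => by
    rw [eval_linearForm]
    exact ⟨hv x t hxt, by simp [evalAt]⟩⟩

theorem isRationalOn_sum {κ : Type*} (s : Finset κ) {f : κ → E d → E d → ℝ}
    (hf : ∀ k ∈ s, IsRationalOn n D (f k)) : IsRationalOn n D fun x t => ∑ k ∈ s, f k x t := by
  classical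
  induction s using Finset.induction_on with
  | empty => simpa using isRationalOn_const 0
  | insert a s ha ih =>
    refine ((hf a (by simp)).add (ih fun k hk => hf k (by simp [hk]))).congr fun x t _ => ?_
    rw [Finset.sum_insert ha]

/-- The degree bound `|A| + |B| - 2`: one factor affine in `t` for each cut edge, except for the last
one, where the factor cancels against the denominator in the base case `n / h i`. -/
theorem isRationalOn_sectionDensity {ι : Type*} (N : ℕ) (v : ι → E d) : ∀ (A B : List ι),
    A ≠ [] → B ≠ [] → (∀ x t, (x, t) ∈ D → ∀ i ∈ A, 0 < inner ℝ x (v i + t)) →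
    (∀ x t, (x, t) ∈ D → ∀ i ∈ B, inner ℝ x (v i + t) < 0) →
    IsRationalOn (A.length + B.length - 2) D
      fun x t => sectionDensity N A B fun i => inner ℝ x (v i + t)
  | [], _, h, _, _, _ => absurd rfl h
  | _ :: _, [], _, h, _, _ => absurd rfl h
  | i :: A, j :: B, _, _, hA, hB => by
    have hsub : ∀ x t : E d, inner ℝ x (v i + t) - inner ℝ x (v j + t) = inner ℝ x (v i - v j) := by
      intro x t
      rw [← inner_sub_right, add_sub_add_right_eq_sub]
    have hne : ∀ x t, (x, t) ∈ D → inner ℝ x (v i - v j) ≠ 0 := by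
      intro x t hxt
      rw [← hsub x t]
      have := hA x t hxt i (by simp)
      have := hB x t hxt j (by simp)
      linarith
    have hinv := isRationalOn_inv_inner hne
    have hA' := fun x t hxt l (hl : l ∈ A) => hA x t hxt l (List.mem_cons_of_mem _ hl)
    have hB' := fun x t hxt l (hl : l ∈ B) => hB x t hxt l (List.mem_cons_of_mem _ hl)
    -- the two summands of the recursion
    have h1 : A ≠ [] → IsRationalOn (A.length + B.length) D fun x t =>
        -inner ℝ x (v j + t) * sectionDensity N A (j :: B) fun i => inner ℝ x (v i + t) := by
      intro hne
      have ih := isRationalOn_sectionDensity N v A (j :: B) hne (by simp) hA' hB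
      have hpos := List.length_pos_iff.2 hne
      have := (((isRationalOn_const (n := 0) (D := D) (-1)).mul
        (isRationalOn_inner_add (v j))).mul ih)
      rw [show 0 + 1 + (A.length + (j :: B).length - 2) = A.length + B.length by
        simp only [List.length_cons]; omega] at this
      exact this.congr fun x t _ => by ring
    have h2 : B ≠ [] → IsRationalOn (A.length + B.length) D fun x t =>
        inner ℝ x (v i + t) * sectionDensity N (i :: A) B fun i => inner ℝ x (v i + t) := by
      intro hne
      have ih := isRationalOn_sectionDensity N v (i :: A) B (by simp) hne hA hB'
      have hpos := List.length_pos_iff.2 hne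
      have := (isRationalOn_inner_add (D := D) (v i)).mul ih
      rwa [show 1 + ((i :: A).length + B.length - 2) = A.length + B.length by
        simp only [List.length_cons]; omega] at this
    have h1' : A = [] → ∀ x t : E d,
        sectionDensity N A (j :: B) (fun i => inner ℝ x (v i + t)) = 0 := by
      rintro rfl x t
      rw [sectionDensity]
    have hlen : (i :: A).length + (j :: B).length - 2 = A.length + B.length + 0 := by
      simp only [List.length_cons]; omega
    rw [hlen]
    suffices hnum : IsRationalOn (A.length + B.length) D fun x t =>
        -inner ℝ x (v j + t) * sectionDensity N A (j :: B) (fun i => inner ℝ x (v i + t)) +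
        inner ℝ x (v i + t) * sectionDensity N (i :: A) B (fun i => inner ℝ x (v i + t)) by
      refine (hnum.mul hinv).congr fun x t _ => ?_
      rw [sectionDensity, hsub, div_eq_mul_inv]
    rcases eq_or_ne A [] with hA0 | hA0 <;> rcases eq_or_ne B [] with hB0 | hB0
    · refine (isRationalOn_const (N : ℝ)).congr fun x t hxt => ?_
      have := hA x t hxt i (by simp)
      rw [h1' hA0, hA0, hB0, sectionDensity]
      field_simp
      ring
    · exact (h2 hB0).congr fun x t _ => by rw [h1' hA0]; ring
    · refine (h1 hA0).congr fun x t _ => ?_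
      obtain ⟨k, A', rfl⟩ := List.exists_cons_of_ne_nil hA0
      rw [hB0, sectionDensity.eq_3]
      ring
    · exact (h1 hA0).add (h2 hB0)
termination_by A B => A.length + B.length

end Rational

/-! ### The radial function of a polytope -/

section Polytope

variable {d : ℕ} {P : Set (E d)}

theorem finite_vertices (hP : IsFullDimPolytope P) : (vertices P).Finite := by
  obtain ⟨⟨S, hS, rfl⟩, -⟩ := hP
  exact hS.subset extremePoints_convexHull_subset

theorem convexHull_vertices (hP : IsFullDimPolytope P) : convexHull ℝ (vertices P) = P := by
  have hfin := finite_vertices hP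
  obtain ⟨⟨S, hS, rfl⟩, -⟩ := hP
  have h := closure_convexHull_extremePoints (hS.isCompact_convexHull ℝ) (convex_convexHull ℝ S)
  exact (hfin.isCompact_convexHull ℝ).isClosed.closure_eq.symm.trans h

theorem interior_nonempty (hP : IsFullDimPolytope P) : (interior P).Nonempty := by
  have hconv : Convex ℝ P := by
    rw [← convexHull_vertices hP]; exact convex_convexHull ℝ _
  exact hconv.interior_nonempty_iff_affineSpan_eq_top.2 hP.2

/-- The radial function of `P + t` as a derivative of slab volumes of the fixed polytope `P`. -/
theorem radialFunction_tendsto (hP : IsFullDimPolytope P) {x t : E d} (hx : x ≠ 0)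
    (hv : ∀ v ∈ vertices P, inner ℝ x (v + t) ≠ 0) :
    Tendsto (fun ε => volume.real (P ∩ slab (innerAffine x (inner ℝ x t)) ε) / ε) (𝓝[>] 0)
      (𝓝 (radialFunction (translate P t) x)) := by
  have hhull : translate P t = convexHull ℝ ((fun y => y + t) '' vertices P) := by
    have := AffineMap.image_convexHull
      (AffineMap.id ℝ (E d) + AffineMap.const ℝ (E d) t) (vertices P)
    rw [convexHull_vertices hP] at this
    exact this
  have hconv : Convex ℝ (translate P t) := hhull ▸ convex_convexHull ℝ _
  have hcomp : IsCompact (translate P t) :=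
    hhull ▸ ((finite_vertices hP).image _).isCompact_convexHull ℝ
  have hint : (interior (translate P t)).Nonempty := by
    obtain ⟨y, hy⟩ := interior_nonempty hP
    refine ⟨y + t, ?_⟩
    have := (Homeomorph.addRight t).image_interior P
    have h2 : y + t ∈ (Homeomorph.addRight t) '' interior P := ⟨y, hy, rfl⟩
    rw [this] at h2
    exact h2
  have h := tendsto_volume_slab_div hconv hcomp hx
    (exists_interior_orthogonal_or_forall_ne hconv hint hhull (by
      rintro _ ⟨v, hvP, rfl⟩
      exact hv v hvP))
  rw [finrank_euclideanSpace_fin] at h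
  refine h.congr fun ε => ?_
  congr 1
  have himg : translate P t ∩ slab (innerAffine x 0) ε =
      (fun y => y + t) '' (P ∩ slab (innerAffine x (inner ℝ x t)) ε) := by
    ext y
    constructor
    · rintro ⟨⟨z, hz, rfl⟩, hs⟩
      exact ⟨z, ⟨hz, by simpa [slab, inner_add_right] using hs⟩, rfl⟩
    · rintro ⟨z, ⟨hz, hs⟩, rfl⟩
      exact ⟨⟨z, hz, rfl⟩, by simpa [slab, inner_add_right] using hs⟩
  rw [himg, measureReal_def, Set.image_add_right, measure_preimage_add_right, measureReal_def]

/-- On any set of pairs `(x, t)` where each vertex of `P + t` lies on a prescribed strict side of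
`x^⊥`, the radial function is rational in `x` and polynomial of degree at most `d - 1` in `t`. -/
theorem isRationalOn_radialFunction (hd : 1 ≤ d) (hP : IsFullDimPolytope P) (pos : E d → Prop)
    {D : Set (E d × E d)}
    (hpos : ∀ x t, (x, t) ∈ D → ∀ v ∈ vertices P, pos v → 0 < inner ℝ x (v + t))
    (hneg : ∀ x t, (x, t) ∈ D → ∀ v ∈ vertices P, ¬ pos v → inner ℝ x (v + t) < 0) :
    IsRationalOn (d - 1) D fun x t => radialFunction (translate P t) x := by
  classical
  have hcoe : ((finite_vertices hP).toFinset : Set (E d)) = vertices P := by simp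
  obtain ⟨T, hT, hvol⟩ := exists_triangulation volume (finite_vertices hP).toFinset
  rw [hcoe] at hT hvol
  rw [convexHull_vertices hP] at hvol
  let A := fun b : AffineBasis (Fin (Module.finrank ℝ (E d) + 1)) ℝ (E d) =>
    (Finset.univ.filter fun i => pos (b i)).toList
  let B := fun b : AffineBasis (Fin (Module.finrank ℝ (E d) + 1)) ℝ (E d) =>
    (Finset.univ.filter fun i => ¬ pos (b i)).toList
  have hA : ∀ b i, i ∈ A b ↔ pos (b i) := by simp [A]
  have hB : ∀ b i, i ∈ B b ↔ ¬ pos (b i) := by simp [B]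
  have hlen : ∀ b, (A b).length + (B b).length = d + 1 := by
    intro b
    simp only [A, B, Finset.length_toList]
    rw [Finset.card_filter_add_card_filter_not]
    simp
  have hposT : ∀ x t, (x, t) ∈ D → ∀ b ∈ T, ∀ i ∈ A b, 0 < inner ℝ x (b i + t) :=
    fun x t hxt b hb i hi => hpos x t hxt _ (hT b hb (mem_range_self i)) ((hA b i).1 hi)
  have hnegT : ∀ x t, (x, t) ∈ D → ∀ b ∈ T, ∀ i ∈ B b, inner ℝ x (b i + t) < 0 :=
    fun x t hxt b hb i hi => hneg x t hxt _ (hT b hb (mem_range_self i)) ((hB b i).1 hi)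
  have hformula : ∀ x t, (x, t) ∈ D → radialFunction (translate P t) x =
      ∑ b ∈ T, sectionDensity (Module.finrank ℝ (E d)) (A b) (B b) (fun i => inner ℝ x (b i + t)) *
        volume.real (convexHull ℝ (range b)) := by
    intro x t hxt
    have hne : ∀ v ∈ vertices P, inner ℝ x (v + t) ≠ 0 := fun v hv => by
      by_cases h : pos v
      · exact (hpos x t hxt v hv h).ne'
      · exact (hneg x t hxt v hv h).ne
    obtain ⟨v, hv⟩ : (vertices P).Nonempty := by
      rw [← convexHull_nonempty_iff (𝕜 := ℝ), convexHull_vertices hP]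
      exact (interior_nonempty hP).mono interior_subset
    have hx : x ≠ 0 := by
      rintro rfl
      exact hne v hv (inner_zero_left _)
    have hh : ∀ y, innerAffine x (inner ℝ x t) y = inner ℝ x (y + t) := fun y => by
      rw [innerAffine_apply, inner_add_right]
    refine tendsto_nhds_unique (radialFunction_tendsto hP hx hne) ?_
    have hsum := tendsto_finsetSum T fun b hb =>
      tendsto_measure_simplex_slab volume (h := innerAffine x (inner ℝ x t)) (y₀ := v)
        (by rw [hh]; exact hne v hv) (k := fun i => inner ℝ x (b i + t)) (A b) (B b) b
        (List.nodup_append.2 ⟨Finset.nodup_toList _, Finset.nodup_toList _, fun i hi j hj e =>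
          (hB b j).1 hj (e ▸ (hA b i).1 hi)⟩)
        (hposT x t hxt b hb) (hnegT x t hxt b hb) (fun i _ => hh _)
        (fun i hi => absurd (List.mem_append.2 ((em (pos (b i))).imp (hA b i).2 (hB b i).2)) hi)
    refine hsum.congr fun ε => ?_
    rw [hvol _ (measurableSet_slab _ ε), Finset.sum_div]
  refine (isRationalOn_sum T fun b hb => ?_).congr hformula
  suffices h : IsRationalOn (d - 1) D fun x t =>
      sectionDensity (Module.finrank ℝ (E d)) (A b) (B b) fun i => inner ℝ x (b i + t) from
    h.mul (isRationalOn_const (n := 0) _)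
  have hl := hlen b
  rcases eq_or_ne (A b) [] with hA0 | hA0
  · refine (isRationalOn_const 0).congr fun x t _ => ?_
    rw [hA0, sectionDensity]
  rcases eq_or_ne (B b) [] with hB0 | hB0
  · refine (isRationalOn_const 0).congr fun x t _ => ?_
    rw [hB0, List.length_nil] at hl
    match hAb : A b, hl with
    | [], hl => simp at hl
    | [_], hl => simp at hl; omega
    | _ :: _ :: _, _ => rw [hB0, sectionDensity]
  · have := isRationalOn_sectionDensity (D := D) (Module.finrank ℝ (E d)) b (A b) (B b) hA0 hB0
      (fun x t hxt => hposT x t hxt b hb) (fun x t hxt => hnegT x t hxt b hb)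
    rwa [hl, show d + 1 - 2 = d - 1 by omega] at this

end Polytope

end IntersectionBody

theorem theorem3p5 {d : ℕ} (hd : 1 ≤ d) (P : Set (IntersectionBody.E d))
    (hP : IntersectionBody.IsFullDimPolytope P)
    (R : Set (IntersectionBody.E d)) (hR : IntersectionBody.IsRegion P R)
    (t₀ : IntersectionBody.E d) (ht₀ : t₀ ∈ R)
    (C₀ : Set (IntersectionBody.E d))
    (hC₀ : IntersectionBody.IsChamber (IntersectionBody.translate P t₀) C₀) :
    ∃ (p : MvPolynomial (Fin d) (MvPolynomial (Fin d) ℝ)) (q : MvPolynomial (Fin d) ℝ),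
      p.totalDegree ≤ d - 1 ∧
      ∀ t ∈ R, ∀ C : Set (IntersectionBody.E d),
        IntersectionBody.IsChamber (IntersectionBody.translate P t) C →
        IntersectionBody.SameSignVector P t₀ C₀ t C →
        ∀ x ∈ C, MvPolynomial.eval (fun i => x i) q ≠ 0 ∧
          IntersectionBody.radialFunction (IntersectionBody.translate P t) x =
            IntersectionBody.evalAt p x t / MvPolynomial.eval (fun i => x i) q := by
  obtain ⟨x₀, hx₀, rfl⟩ := hC₀
  have hmem := mem_connectedComponentIn hx₀
  set C₀ := connectedComponentIn
    (IntersectionBody.centralArrangement (IntersectionBody.translate P t₀))ᶜ x₀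
  obtain ⟨p, q, hp, H⟩ := IntersectionBody.isRationalOn_radialFunction hd hP
    (fun v => C₀ ⊆ IntersectionBody.posSide (v + t₀))
    (D := {y | ∃ C, IntersectionBody.SameSignVector P t₀ C₀ y.2 C ∧ y.1 ∈ C})
    (by
      rintro x t ⟨C, hC, hx⟩ v hv hpos
      rcases hC v hv with h | h
      · exact h.2 hx
      · have h1 : inner ℝ x₀ (v + t₀) < 0 := h.1 hmem
        have h2 : 0 < inner ℝ x₀ (v + t₀) := hpos hmem
        exact absurd h1 h2.not_gt)
    (by
      rintro x t ⟨C, hC, hx⟩ v hv hpos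
      rcases hC v hv with h | h
      · exact absurd h.1 hpos
      · exact h.2 hx)
  exact ⟨p, q, hp, fun t _ C _ hsign x hx => H x t ⟨C, hsign, hx⟩⟩
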